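/- Let $l \ge 0$, let $\mathbf{k} = (k_1,\dots,k_l)$ be a tuple of integers with $k_i \ge 3$ for all $i$, let $n \ge 3$, and put $N = 2 + k_1 + \dots + k_l + n$. Let $\mathbf{B}_m$ denote the Artin braid group on $m$ strands, and let $\mathbf{B}_{2,\mathbf{k},n} \subseteq \mathbf{B}_N$ be the partitioned braid group, that is, the subgroup of the braids whose underlying permutation of the $N$ positions preserves each block of the partition of the positions into consecutive blocks of sizes $2, k_1, \dots, k_l, n$. Let $\mathbf{B}_{2,\mathbf{k},n} \to \mathbf{B}_n$ be the (split surjective) homomorphism that forgets all strands except those in the last block, of size $n$. For a group $G$, let $\varGamma_1(G) = G$ and $\varGamma_{r+1}(G) = [G, \varGamma_r(G)]$ be its lower central series. For $r \ge 2$, let \[ Q_r = \ker\bigl( \mathbf{B}_{2,\mathbf{k},n}/\varGamma_r(\mathbf{B}_{2,\mathbf{k},n}) \longrightarrow \mathbf{B}_n/\varGamma_r(\mathbf{B}_n) \bigr) \] be the kernel of the induced homomorphism. Then for every $r \ge 2$ there is an isomorphism of groups \[ Q_r \;\cong\; \mathbb{Z}^{\binom{l+2}{2} - 1} \times \Bigl(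 \bigl(\mathbb{Z}^2/2^{r-2}\bar{\Delta}\bigr)^{l+1} \rtimes \mathbb{Z} \Bigr), \] where $\bar{\Delta} = (1,-1) \in \mathbb{Z}^2$, $\mathbb{Z}^2/2^{r-2}\bar{\Delta}$ is the quotient of $\mathbb{Z}^2$ by the subgroup generated by $2^{r-2}\bar{\Delta}$, and $1 \in \mathbb{Z}$ acts on each of the $l+1$ copies of $\mathbb{Z}^2/2^{r-2}\bar{\Delta}$ by swapping the two coordinates. -/

import Mathlib

open scoped Pointwise

/-! ## Artin braid groups -/

/-- The defining relators of the braid group on `n` strands, in the letters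
`σ_0, …, σ_{n-2}`: far commutation and the braid relation. -/
def braidRels (n : ℕ) : Set (FreeGroup (Fin (n - 1))) :=
  {w | ∃ i j : Fin (n - 1), (i : ℕ) + 1 < j ∧
      w = .of i * .of j * (.of j * .of i)⁻¹} ∪
  {w | ∃ i j : Fin (n - 1), (i : ℕ) + 1 = j ∧
      w = .of i * .of j * .of i * (.of j * .of i * .of j)⁻¹}

/-- The braid group `B_n` on `n` strands, by Artin's presentation. -/
abbrev BraidGroup (n : ℕ) : Type := PresentedGroup (braidRels n)

namespace BraidGroup

/-- The standard generator `σ_i`, exchanging the strands in positions `i` and `i + 1`. -/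
def σ {n : ℕ} (i : Fin (n - 1)) : BraidGroup n := PresentedGroup.of i

theorem σ_comm {n : ℕ} (i j : Fin (n - 1)) (h : (i : ℕ) + 1 < j) :
    σ i * σ j = σ j * σ i := by
  have := PresentedGroup.one_of_mem (rels := braidRels n) (Or.inl ⟨i, j, h, rfl⟩)
  rw [map_mul, map_inv, map_mul, map_mul] at this
  exact mul_inv_eq_one.mp this

theorem σ_braid {n : ℕ} (i j : Fin (n - 1)) (h : (i : ℕ) + 1 = j) :
    σ i * σ j * σ i = σ j * σ i * σ j := by
  have := PresentedGroup.one_of_mem (rels := braidRels n) (Or.inr ⟨i, j, h, rfl⟩)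
  rw [map_mul, map_inv, map_mul, map_mul, map_mul, map_mul] at this
  exact mul_inv_eq_one.mp this

/-- To define a homomorphism out of `B_n` it suffices to check the braid relations. -/
def lift {n : ℕ} {G : Type*} [Group G] (f : Fin (n - 1) → G)
    (hc : ∀ i j : Fin (n - 1), (i : ℕ) + 1 < j → f i * f j = f j * f i)
    (hb : ∀ i j : Fin (n - 1), (i : ℕ) + 1 = j → f i * f j * f i = f j * f i * f j) :
    BraidGroup n →* G :=
  PresentedGroup.toGroup (rels := braidRels n) (f := f) (by
    rintro r (⟨i, j, h, rfl⟩ | ⟨i, j, h, rfl⟩)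
    · simp only [map_mul, map_inv, FreeGroup.lift_apply_of]
      exact mul_inv_eq_one.mpr (hc i j h)
    · simp only [map_mul, map_inv, FreeGroup.lift_apply_of]
      exact mul_inv_eq_one.mpr (hb i j h))

@[simp] theorem lift_σ {n : ℕ} {G : Type*} [Group G] (f : Fin (n - 1) → G) (hc) (hb)
    (i : Fin (n - 1)) : lift f hc hb (σ i) = f i :=
  PresentedGroup.toGroup.of _

/-- The position `i`, for `i : Fin (N - 1)`. -/
def posL {N : ℕ} (i : Fin (N - 1)) : Fin N := ⟨i, by omega⟩

/-- The position `i + 1`, for `i : Fin (N - 1)`. -/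
def posR {N : ℕ} (i : Fin (N - 1)) : Fin N := ⟨i + 1, by omega⟩

/-- The transposition of the positions `i` and `i + 1`. -/
def adjSwap {N : ℕ} (i : Fin (N - 1)) : Equiv.Perm (Fin N) := Equiv.swap (posL i) (posR i)

theorem adjSwap_of_ne {N : ℕ} (i : Fin (N - 1)) (p : Fin N) (h : (p : ℕ) ≠ i)
    (h' : (p : ℕ) ≠ i + 1) : adjSwap i p = p :=
  Equiv.swap_apply_of_ne_of_ne (fun e => h (congrArg Fin.val e)) (fun e => h' (congrArg Fin.val e))

theorem adjSwap_inv {N : ℕ} (i : Fin (N - 1)) : (adjSwap i)⁻¹ = adjSwap i := Equiv.swap_inv _ _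

theorem adjSwap_comm {N : ℕ} (i j : Fin (N - 1)) (h : (i : ℕ) + 1 < j) :
    adjSwap i * adjSwap j = adjSwap j * adjSwap i := by
  apply Equiv.Perm.Disjoint.commute
  intro p
  by_cases hp : (p : ℕ) ≤ i + 1
  · exact Or.inr (adjSwap_of_ne _ _ (by omega) (by omega))
  · exact Or.inl (adjSwap_of_ne _ _ (by omega) (by omega))

theorem adjSwap_braid {N : ℕ} (i j : Fin (N - 1)) (h : (i : ℕ) + 1 = j) :
    adjSwap i * adjSwap j * adjSwap i = adjSwap j * adjSwap i * adjSwap j := by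
  have hL : posL j = posR i := Fin.ext h.symm
  have h1 : (posL i : Fin N) ≠ posR i := by simp [posL, posR, Fin.ext_iff]
  have h2 : (posR i : Fin N) ≠ posR j := by simp [posR, Fin.ext_iff]; omega
  have h3 : (posL i : Fin N) ≠ posR j := by simp [posL, posR, Fin.ext_iff]; omega
  unfold adjSwap
  have e1 := Equiv.swap_mul_swap_mul_swap h2.symm h3.symm
  have e2 := Equiv.swap_mul_swap_mul_swap h1 h3
  rw [Equiv.swap_comm (posR i) (posL i), Equiv.swap_comm (posR j) (posR i)] at e1
  rw [Equiv.swap_comm (posR j) (posL i)] at e2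
  rw [hL, e1, e2]

/-- The permutation underlying a braid. -/
def perm (N : ℕ) : BraidGroup N →* Equiv.Perm (Fin N) :=
  lift adjSwap adjSwap_comm adjSwap_braid

/-! ## Deleting strands

A braid word is read from left to right.  Let `S` be the set of positions occupied, before the
letter `σ_i`, by the strands that we keep.  If both `i` and `i + 1` lie in `S`, the letter survives
as `σ_k`, where `k` is the number of kept strands to the left of position `i`; otherwise it becomes
trivial.  After the letter, the kept strands occupy the positions `s_i • S`.  A word in the letters
`σ_i` therefore acts through the wreath product `(X → B_n) ⋊ S_N`, where `X` is the set of
`n`-element sets of positions. -/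

/-- The number of elements of `S` to the left of position `p`. -/
def rank {N n : ℕ} (S : Set.powersetCard (Fin N) n) (p : Fin N) : ℕ :=
  ((S : Finset (Fin N)).filter (· < p)).card

theorem rank_posR {N n : ℕ} (S : Set.powersetCard (Fin N) n) (i : Fin (N - 1)) :
    rank S (posR i) = rank S (posL i) + if posL i ∈ (S : Finset (Fin N)) then 1 else 0 := by
  unfold rank
  have h : (S : Finset (Fin N)).filter (· < posR i) =
      (S : Finset (Fin N)).filter (· < posL i) ∪
        (S : Finset (Fin N)).filter (· = posL i) := by
    ext p
    simp only [Finset.mem_filter, Finset.mem_union, posL, posR, Fin.lt_def, Fin.ext_iff]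
    constructor
    · rintro ⟨a, b⟩
      rcases Nat.lt_or_ge p i with c | c
      · exact Or.inl ⟨a, c⟩
      · exact Or.inr ⟨a, by omega⟩
    · rintro (⟨a, b⟩ | ⟨a, b⟩) <;> exact ⟨a, by omega⟩
  rw [h, Finset.card_union_of_disjoint, Finset.filter_eq']
  · congr 1
    split_ifs <;> simp
  · rw [Finset.disjoint_left]
    intro p hp hq
    simp only [Finset.mem_filter] at hp hq
    exact absurd hp.2 (by rw [hq.2]; exact lt_irrefl _)

theorem rank_lt {N n : ℕ} (S : Set.powersetCard (Fin N) n) (p : Fin N) (h : p ∈ (S : Finset (Fin N))) :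
    rank S p < n := by
  have hS : (S : Finset (Fin N)).card = n := S.prop
  refine lt_of_lt_of_eq (Finset.card_lt_card ?_) hS
  rw [Finset.filter_ssubset]
  exact ⟨p, h, lt_irrefl _⟩

theorem rank_lt_pred {N n : ℕ} (S : Set.powersetCard (Fin N) n) (i : Fin (N - 1))
    (h : posL i ∈ (S : Finset (Fin N)) ∧ posR i ∈ (S : Finset (Fin N))) : rank S (posL i) < n - 1 := by
  have h1 := rank_lt S _ h.2
  rw [rank_posR, if_pos h.1] at h1
  omega

theorem rank_mono {N n : ℕ} (S : Set.powersetCard (Fin N) n) {p q : Fin N} (h : p ≤ q) :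
    rank S p ≤ rank S q :=
  Finset.card_le_card (Finset.monotone_filter_right _ fun _ _ ha => lt_of_lt_of_le ha h)

theorem mem_adjSwap_smul {N n : ℕ} (S : Set.powersetCard (Fin N) n) (i : Fin (N - 1))
    (p : Fin N) :
    p ∈ ((adjSwap i • S : Set.powersetCard (Fin N) n) : Finset (Fin N)) ↔
      adjSwap i p ∈ (S : Finset (Fin N)) := by
  rw [Set.powersetCard.coe_smul, ← Finset.inv_smul_mem_iff, adjSwap_inv, Equiv.Perm.smul_def]

theorem rank_adjSwap_smul {N n : ℕ} (S : Set.powersetCard (Fin N) n) (i : Fin (N - 1))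
    (p : Fin N) (hp : (p : ℕ) ≠ i + 1) : rank (adjSwap i • S) p = rank S p := by
  unfold rank
  rw [← Finset.card_smul_finset (adjSwap i) ((S : Finset (Fin N)).filter (· < p))]
  congr 1
  ext q
  rw [← Finset.inv_smul_mem_iff, adjSwap_inv, Finset.mem_filter, Finset.mem_filter,
    mem_adjSwap_smul, Equiv.Perm.smul_def]
  refine and_congr_right fun _ => ?_
  by_cases h1 : (q : ℕ) = i
  · have : q = posL i := Fin.ext h1
    rw [this, adjSwap, Equiv.swap_apply_left]
    simp only [posL, posR, Fin.lt_def]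
    omega
  · by_cases h2 : (q : ℕ) = i + 1
    · have : q = posR i := Fin.ext h2
      rw [this, adjSwap, Equiv.swap_apply_right]
      simp only [posL, posR, Fin.lt_def]
      omega
    · rw [adjSwap_of_ne i q h1 h2]

/-- What remains of the letter `σ_i` when exactly the strands in the positions `S` are kept. -/
def keepLetter {N : ℕ} (n : ℕ) (i : Fin (N - 1)) (S : Set.powersetCard (Fin N) n) :
    BraidGroup n :=
  if h : posL i ∈ (S : Finset (Fin N)) ∧ posR i ∈ (S : Finset (Fin N)) then
    σ ⟨rank S (posL i), rank_lt_pred S i h⟩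
  else 1

theorem keepLetter_smul_far {N n : ℕ} (i j : Fin (N - 1))
    (h : (i : ℕ) + 1 < j ∨ (j : ℕ) + 1 < i) (S : Set.powersetCard (Fin N) n) :
    keepLetter n i (adjSwap j • S) = keepLetter n i S := by
  have hL : adjSwap j (posL i) = posL i := 
    adjSwap_of_ne _ _ (by simp only [posL]; omega) (by simp only [posL]; omega)
  have hR : adjSwap j (posR i) = posR i := 
    adjSwap_of_ne _ _ (by simp only [posR]; omega) (by simp only [posR]; omega)
  have hr : rank (adjSwap j • S) (posL i) = rank S (posL i) :=
    rank_adjSwap_smul S j _ (by simp only [posL]; omega)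
  simp only [keepLetter, mem_adjSwap_smul, hL, hR, hr]

theorem keepLetter_comm {N n : ℕ} (i j : Fin (N - 1)) (h : (i : ℕ) + 1 < j)
    (S : Set.powersetCard (Fin N) n) :
    keepLetter n i S * keepLetter n j S = keepLetter n j S * keepLetter n i S := by
  unfold keepLetter
  split_ifs with hi hj hj
  · apply σ_comm
    have h1 : rank S (posR i) = rank S (posL i) + 1 := by rw [rank_posR, if_pos hi.1]
    have h2 : rank S (posL j) ≥ rank S (posR i) + 1 := by
      have h3 : rank S (posR ⟨(i : ℕ) + 1, by omega⟩) = rank S (posR i) + 1 := by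
        rw [rank_posR]
        have : (posL ⟨(i : ℕ) + 1, by omega⟩ : Fin N) = posR i := rfl
        rw [this, if_pos hi.2]
      rw [← h3]
      apply rank_mono
      simp only [posL, posR, Fin.le_def]
      omega
    simp only
    omega
  all_goals simp

theorem keepLetter_braid {N n : ℕ} (i j : Fin (N - 1)) (h : (i : ℕ) + 1 = j)
    (S : Set.powersetCard (Fin N) n) :
    keepLetter n i S * keepLetter n j (adjSwap i • S) *
        keepLetter n i (adjSwap j • adjSwap i • S) =
      keepLetter n j S * keepLetter n i (adjSwap j • S) *
        keepLetter n j (adjSwap i • adjSwap j • S) := by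
  have hLj : posL j = posR i := by ext; simp only [posL, posR]; omega
  have hne : posL i ≠ posR i := by simp [posL, posR, Fin.ext_iff]
  have e1 : adjSwap i (posL i) = posR i := by simp [adjSwap]
  have e2 : adjSwap i (posR i) = posL i := by simp [adjSwap]
  have e3 : adjSwap i (posR j) = posR j := 
    adjSwap_of_ne _ _ (by simp only [posR]; omega) (by simp only [posR]; omega)
  have e4 : adjSwap j (posL i) = posL i := 
    adjSwap_of_ne _ _ (by simp only [posL]; omega) (by simp only [posL]; omega)
  have e5 : adjSwap j (posR i) = posR j := by rw [← hLj]; simp [adjSwap]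
  have e6 : adjSwap j (posR j) = posR i := by rw [← hLj]; simp [adjSwap]
  have r1 (T : Set.powersetCard (Fin N) n) : rank (adjSwap i • T) (posL i) = rank T (posL i) :=
    rank_adjSwap_smul T i _ (by simp [posL])
  have r2 (T : Set.powersetCard (Fin N) n) : rank (adjSwap j • T) (posL i) = rank T (posL i) :=
    rank_adjSwap_smul T j _ (by simp only [posL]; omega)
  simp only [keepLetter, hLj, mem_adjSwap_smul, e1, e2, e3, e4, e5, e6, rank_posR, r1, r2]
  by_cases a : posL i ∈ (S : Finset (Fin N)) <;> by_cases b : posR i ∈ (S : Finset (Fin N)) <;>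
    by_cases c : posR j ∈ (S : Finset (Fin N)) <;> simp [a, b, c]
  apply σ_braid
  rfl

/-- The homomorphism `B_N → (X → B_n) ⋊ S_N` recording all deletions of strands that
leave `n` strands, together with the underlying permutation. -/
def keepAll (N n : ℕ) :
    BraidGroup N →*
      (Set.powersetCard (Fin N) n → BraidGroup n) ⋊[mulAutArrow] Equiv.Perm (Fin N) :=
  lift (fun i => ⟨keepLetter n i, adjSwap i⟩)
    (by
      intro i j h
      refine SemidirectProduct.ext ?_ (adjSwap_comm i j h)
      funext S
      change keepLetter n i S * keepLetter n j ((adjSwap i)⁻¹ • S) =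
        keepLetter n j S * keepLetter n i ((adjSwap j)⁻¹ • S)
      rw [adjSwap_inv, adjSwap_inv, keepLetter_smul_far i j (Or.inl h), keepLetter_smul_far j i (Or.inr h)]
      exact keepLetter_comm i j h S)
    (by
      intro i j h
      refine SemidirectProduct.ext ?_ (adjSwap_braid i j h)
      funext S
      change keepLetter n i S * keepLetter n j ((adjSwap i)⁻¹ • S) *
          keepLetter n i ((adjSwap i * adjSwap j)⁻¹ • S) =
        keepLetter n j S * keepLetter n i ((adjSwap j)⁻¹ • S) *
          keepLetter n j ((adjSwap j * adjSwap i)⁻¹ • S)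
      rw [mul_inv_rev, mul_inv_rev, adjSwap_inv, adjSwap_inv, mul_smul, mul_smul]
      exact keepLetter_braid i j h S)

theorem keepAll_right (N n : ℕ) (β : BraidGroup N) : (keepAll N n β).right = perm N β := by
  have : SemidirectProduct.rightHom.comp (keepAll N n) = perm N := by
    apply PresentedGroup.ext
    intro i
    change (keepAll N n (σ i)).right = perm N (σ i)
    simp [keepAll, perm]
  exact DFunLike.congr_fun this β

end BraidGroup

/-! ## Partitioned braid groups -/

/-- The block of the position `p`, when the positions `0, …, ∑ i, lam i - 1` are cut, from left
to right, into consecutive blocks of sizes `lam 0, …, lam (m - 1)`. -/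
def blockOf {m : ℕ} (lam : Fin m → ℕ) (p : Fin (∑ i, lam i)) : Fin m :=
  (finSigmaFinEquiv.symm p).1

/-- The set of positions in the block `j`. -/
def blockSet {m : ℕ} (lam : Fin m → ℕ) (j : Fin m) :
    Set.powersetCard (Fin (∑ i, lam i)) (lam j) :=
  ⟨Finset.univ.filter fun p => blockOf lam p = j, by
    have : (Finset.univ.filter fun p => blockOf lam p = j) =
        (Finset.univ : Finset (Fin (lam j))).map
          ⟨fun x => finSigmaFinEquiv (⟨j, x⟩ : (i : Fin m) × Fin (lam i)), fun x y h => by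
            simpa using h⟩ := by
      ext p
      obtain ⟨⟨i, x⟩, rfl⟩ := finSigmaFinEquiv.surjective p
      rw [Finset.mem_filter, Finset.mem_map]
      constructor
      · rintro ⟨-, h⟩
        have h' : i = j := by simpa [blockOf] using h
        subst h'
        exact ⟨x, Finset.mem_univ _, rfl⟩
      · rintro ⟨y, -, hy⟩
        exact ⟨Finset.mem_univ _, by
          rw [← hy]
          change (finSigmaFinEquiv.symm (finSigmaFinEquiv _)).1 = j
          rw [Equiv.symm_apply_apply]⟩
    change Finset.card _ = _
    rw [this, Finset.card_map, Finset.card_univ, Fintype.card_fin]⟩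

/-- The Young subgroup `S_lam`: permutations mapping each block to itself. -/
def youngSubgroup {m : ℕ} (lam : Fin m → ℕ) : Subgroup (Equiv.Perm (Fin (∑ i, lam i))) where
  carrier := {π | ∀ p, blockOf lam (π p) = blockOf lam p}
  one_mem' _ := rfl
  mul_mem' {π ρ} hπ hρ p := (hπ (ρ p)).trans (hρ p)
  inv_mem' {π} hπ p := by
    have := hπ (π⁻¹ p)
    rw [← Equiv.Perm.mul_apply, mul_inv_cancel, Equiv.Perm.one_apply] at this
    exact this.symm

/-- The partitioned braid group `B_lam`: braids on `∑ i, lam i` strands whose permutation maps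
each block to itself. -/
def partBraidGroup {m : ℕ} (lam : Fin m → ℕ) : Subgroup (BraidGroup (∑ i, lam i)) :=
  (youngSubgroup lam).comap (BraidGroup.perm _)

theorem youngSubgroup_smul {m : ℕ} (lam : Fin m → ℕ) (j : Fin m)
    {π : Equiv.Perm (Fin (∑ i, lam i))} (hπ : π ∈ youngSubgroup lam) :
    π • blockSet lam j = blockSet lam j := by
  apply Subtype.ext
  rw [Set.powersetCard.coe_smul]
  ext p
  have h := (youngSubgroup lam).inv_mem hπ p
  rw [← Finset.inv_smul_mem_iff]
  change π⁻¹ p ∈ Finset.univ.filter (fun p => blockOf lam p = j) ↔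
    p ∈ Finset.univ.filter (fun p => blockOf lam p = j)
  rw [Finset.mem_filter, Finset.mem_filter, h]
  simp

/-- The homomorphism `B_lam → B_{lam j}` forgetting all strands outside the block `j`. -/
def keepBlock {m : ℕ} (lam : Fin m → ℕ) (j : Fin m) :
    partBraidGroup lam →* BraidGroup (lam j) where
  toFun β := (BraidGroup.keepAll _ (lam j) (β : BraidGroup (∑ i, lam i))).left (blockSet lam j)
  map_one' := by simp
  map_mul' β γ := by
    have hβ : (BraidGroup.keepAll _ (lam j) (β : BraidGroup (∑ i, lam i))).right ∈ youngSubgroup lam := by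
      rw [BraidGroup.keepAll_right]; exact β.2
    rw [Subgroup.coe_mul, map_mul, SemidirectProduct.mul_left, Pi.mul_apply]
    congr 1
    change (BraidGroup.keepAll _ (lam j) (γ : BraidGroup (∑ i, lam i))).left
      ((BraidGroup.keepAll _ (lam j) (β : BraidGroup (∑ i, lam i))).right⁻¹ • blockSet lam j) = _
    rw [youngSubgroup_smul lam j ((youngSubgroup lam).inv_mem hβ)]

/-! ## The layer groups -/

/-- The lower central series `Γ_1(G) = G`, `Γ_{r+1}(G) = [Γ_r(G), G]`, indexed from `r = 1`. -/
abbrev Gam (r : ℕ) (G : Type*) [Group G] : Subgroup G :=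
  (⊤ : Subgroup G).lowerCentralSeries (r - 1)

theorem Gam_le_comap (r : ℕ) {G H : Type*} [Group G] [Group H] (f : G →* H) :
    Gam r G ≤ (Gam r H).comap f := by
  rw [← Subgroup.map_le_iff_le_comap, Subgroup.map_lowerCentralSeries]
  exact Subgroup.lowerCentralSeries_mono _ le_top

/-- For a homomorphism `f : G → H`, the kernel of the induced homomorphism
`G / Γ_r(G) → H / Γ_r(H)`. -/
abbrev layerGroup (r : ℕ) {G H : Type*} [Group G] [Group H] (f : G →* H) :
    Subgroup (G ⧸ Gam r G) :=
  (QuotientGroup.map (Gam r G) (Gam r H) f (Gam_le_comap r f)).ker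

/-- The tuple of block sizes `(2, k_1, …, k_l, n)`. -/
def blocks2kn {l : ℕ} (k : Fin l → ℕ) (n : ℕ) : Fin (l + 2) → ℕ :=
  Fin.snoc (Fin.cons 2 k : Fin (l + 1) → ℕ) n

theorem blocks2kn_last {l : ℕ} (k : Fin l → ℕ) (n : ℕ) :
    blocks2kn k n (Fin.last (l + 1)) = n :=
  Fin.snoc_last _ _

/-- The group `Q_r` for the surjection `B_{2,k,n} → B_n` forgetting all strands outside the
last block (of size `blocks2kn k n (Fin.last _) = n`). -/
abbrev LayerQ {l : ℕ} (k : Fin l → ℕ) (n r : ℕ) : Type :=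
  layerGroup r (keepBlock (blocks2kn k n) (Fin.last (l + 1)))

/-! ## The explicit groups -/

/-- The group `ℤ² / a • Δ̄`, where `Δ̄ = (1, -1)`. -/
abbrev SqMod (a : ℕ) : Type :=
  (ℤ × ℤ) ⧸ AddSubgroup.zmultiples (a • ((1, -1) : ℤ × ℤ))

/-- The automorphism of `ℤ² / a • Δ̄` induced by swapping the coordinates. -/
def swapMod (a : ℕ) : SqMod a ≃+ SqMod a :=
  QuotientAddGroup.congr _ _ (AddEquiv.prodComm : ℤ × ℤ ≃+ ℤ × ℤ) (by
    rw [AddMonoidHom.map_zmultiples, ← AddSubgroup.zmultiples_neg]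
    simp)

/-- The action of `ℤ` on `(ℤ² / a • Δ̄)^m`, where `1` swaps the coordinates in each copy. -/
def swapAction (a m : ℕ) :
    Multiplicative ℤ →* MulAut (Multiplicative (Fin m → SqMod a)) :=
  zpowersHom _ (AddEquiv.toMultiplicative (AddEquiv.piCongrRight fun _ : Fin m => swapMod a))

/-!
Number the blocks by the colours `0, …, l + 1`, the block of size two having colour `0`. Braids
act on the colourings of the positions by permutations, and the partitioned braid group `H` is the
stabilizer of the sorted colouring. A coloured word `w` is reached from the sorted word by a
positive braid with fewest crossings (`sortBraid`), so `H` is generated by the loops that go to a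
word `p ++ a :: b :: q`, exchange the letters `a` and `b`, and come back (`eq_top_of_loop_mem`).
The loop is trivial for `a < b` (`sortTo_swap`), and the relations of the braid group become
relations between the loops (`isWordCocycle_loopValue`).

In a nilpotent quotient of `H` two elements that satisfy the braid relation are equal
(`eq_of_braid_of_lowerCentralSeries_eq_bot`). Together with the presence of at least three strands
of every colour other than `0`, this forces the value of a loop to depend on the colours `a` and
`b` only, and to be central, unless `b = 0` (`self_eq`, `cross`, `leftValue_self_central`,
`leftValue_desc_central` in the namespace `IsSortedCocycle`). There remain the crossing `s` of the
two strands of colour `0` and, for each other colour `i`, the full twist `A i` of the first of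
these strands with the block `i`. The elements `A i` and `s * A j * s⁻¹` all commute and `s ^ 2`
commutes with all of them. So `s` inverts the commutator of `A i` and `s`, whose powers with
exponent `2 ^ k` therefore lie ever deeper in the lower central series
(`commutator_pow_mem_lowerCentralSeries`). These are the defining relations of
`LinkGroup (2 ^ (r - 2)) l`, the product of the free abelian group on the unordered pairs of
colours other than `0` and of `(ℤ² / 2 ^ (r - 2) • Δ̄)^(l + 1) ⋊ ℤ` (`exists_hom_linkGroup`),
which thus maps onto `H / Γ_r(H)`.

Conversely, counting crossings defines a homomorphism from `H` onto `LinkGroup (2 ^ (r - 2)) l`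
(`isWordCocycle_linkCocycle`, `stabilizerHom`), and the target has trivial `Γ_r`
(`lowerCentralSeries_linkGroup_eq_bot`). Hence both groups are isomorphic
(`exists_quotient_equiv_linkGroup`). Finally, for the braid group on the last block `Γ_r` is the
kernel of the exponent sum (`mem_Gam_iff`), so the layer group is the kernel of one coordinate of
the free abelian factor, which has rank `(l + 2).choose 2`.
-/

open scoped commutatorElement

/-! ### Lower central series and the braid relation -/

theorem Gam_eq_bot_of_comm {A : Type*} [CommGroup A] {r : ℕ} (hr : 2 ≤ r) : Gam r A = ⊥ := by
  rw [eq_bot_iff]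
  refine (Subgroup.lowerCentralSeries_antitone (⊤ : Subgroup A)
    (show 1 ≤ r - 1 by omega)).trans ?_
  rw [Subgroup.lowerCentralSeries_succ, Subgroup.commutator_le]
  intro x _ y _
  rw [Subgroup.mem_bot, commutatorElement_eq_one_iff_mul_comm, mul_comm]

theorem lowerCentralSeries_quotient_Gam (r : ℕ) (G : Type*) [Group G] :
    (⊤ : Subgroup (G ⧸ Gam r G)).lowerCentralSeries (r - 1) = ⊥ := by
  rw [← Subgroup.map_top_of_surjective (QuotientGroup.mk' (Gam r G))
    (QuotientGroup.mk'_surjective _), ← Subgroup.map_lowerCentralSeries, eq_bot_iff]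
  rintro _ ⟨x, hx, rfl⟩
  exact (QuotientGroup.eq_one_iff x).mpr hx

/-- Two elements of a nilpotent group satisfying the braid relation are equal: if `y * x⁻¹` lies in
a term of the lower central series, the braid relation pushes it into the next one. -/
theorem eq_of_braid_of_lowerCentralSeries_eq_bot {Γ : Type*} [Group Γ] {d : ℕ}
    (hd : (⊤ : Subgroup Γ).lowerCentralSeries d = ⊥) {x y : Γ} (h : x * y * x = y * x * y) :
    x = y := by
  have key : ∀ k, y * x⁻¹ ∈ (⊤ : Subgroup Γ).lowerCentralSeries k := by
    intro k
    induction k with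
    | zero => exact Subgroup.mem_top _
    | succ k ih =>
      have h1 : ⁅y * x⁻¹, x⁆ ∈ (⊤ : Subgroup Γ).lowerCentralSeries (k + 1) :=
        Subgroup.commutator_mem_commutator ih (Subgroup.mem_top _)
      have h2 := Subgroup.Normal.conj_mem inferInstance _ h1 x
      have h3 : x * ⁅y * x⁻¹, x⁆ * x⁻¹ = y * x⁻¹ := by
        have : x * ⁅y * x⁻¹, x⁆ * x⁻¹ = (x * y * x) * y⁻¹ * x⁻¹ * x⁻¹ := by
          rw [commutatorElement_def]; group
        rw [this, h]; group
      rwa [h3] at h2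
  have := key d
  rw [hd, Subgroup.mem_bot] at this
  exact (mul_inv_eq_one.mp this).symm

/-! ### Cocycles on words -/

/-- A property of lists that is stable under exchanging two adjacent letters is invariant under
permutations. -/
theorem List.Perm.adjacent_induction {C : Type*} {P : List C → Prop}
    (h : ∀ p a b q, P (p ++ a :: b :: q) → P (p ++ b :: a :: q)) {w w' : List C}
    (hw : w.Perm w') (hP : P w) : P w' := by
  induction hw generalizing P with
  | nil => exact hP
  | cons x _ ih => exact ih (P := fun l => P (x :: l)) (fun p a b q => h (x :: p) a b q) hP
  | swap x y l => exact h [] y x l hP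
  | trans _ _ ih₁ ih₂ => exact ih₂ h (ih₁ h hP)

theorem exists_append_perm_of_count_le {C : Type*} [DecidableEq C] {w0 L : List C}
    (h : ∀ x, L.count x ≤ w0.count x) : ∃ r, (L ++ r).Perm w0 := by
  obtain ⟨l, hl, hs⟩ := List.subperm_ext_iff.mpr fun x (_ : x ∈ L) => h x
  obtain ⟨r, hr⟩ := hs.exists_perm_append
  exact ⟨r, (hr.trans (hl.append_right r)).symm⟩

theorem perm_cross_iff {C : Type*} {w0 p : List C} {v u w : C} {q : List C} :
    (p ++ [w] ++ v :: u :: q).Perm w0 ↔ (p ++ v :: u :: w :: q).Perm w0 := by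
  have h : (p ++ [w] ++ v :: u :: q).Perm (p ++ v :: u :: w :: q) := by
    rw [List.append_assoc]
    exact (List.perm_middle (l₁ := [v, u])).symm.append_left p
  exact ⟨h.symm.trans, h.trans⟩

/-- A cocycle for the action of the braid group on the rearrangements of the word `w0`, with
values in `Γ`: the letter `σ_i` applied to the word `p ++ a :: b :: q`, where `p` has length `i`,
has the value `F p a b q`. The conditions are the defining relations of the braid group. -/
structure IsWordCocycle {C Γ : Type*} [Group Γ] (w0 : List C)
    (F : List C → C → C → List C → Γ) : Prop where
  far : ∀ p a b q c d r, (p ++ a :: b :: (q ++ c :: d :: r)).Perm w0 →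
    F p a b (q ++ c :: d :: r) * F (p ++ b :: a :: q) c d r =
      F (p ++ a :: b :: q) c d r * F p a b (q ++ d :: c :: r)
  braid : ∀ p a b c q, (p ++ a :: b :: c :: q).Perm w0 →
    F p a b (c :: q) * F (p ++ [b]) a c q * F p b c (a :: q) =
      F (p ++ [a]) b c q * F p a c (b :: q) * F (p ++ [c]) a b q

/-- The letters are the colours of strands, `o` is the least colour, it occurs twice in `w0`, and
every other colour that occurs does so at least three times. The cocycle `F` is trivial where two
strands are put out of order, and its values lie in a group where the braid relation forces
equality. -/
structure IsSortedCocycle {C Γ : Type*} [LinearOrder C] [Group Γ] (o : C) (w0 : List C)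
    (F : List C → C → C → List C → Γ) : Prop extends IsWordCocycle w0 F where
  asc : ∀ p a b q, (p ++ a :: b :: q).Perm w0 → a < b → F p a b q = 1
  bot : ∀ c, o ≤ c
  count_bot : w0.count o = 2
  count_ne : ∀ c, c ≠ o → 3 ≤ w0.count c
  eq_of_braid : ∀ x y : Γ, x * y * x = y * x * y → x = y

/-- The value of a cocycle where strands of colours `a` and `b` cross at the left end. -/
def leftValue {C Γ : Type*} [DecidableEq C] (w0 : List C) (F : List C → C → C → List C → Γ)
    (a b : C) : Γ :=
  F [] a b ((w0.erase a).erase b)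

namespace IsSortedCocycle

variable {C Γ : Type*} [LinearOrder C] [Group Γ] {o : C} {w0 : List C}
  {F : List C → C → C → List C → Γ}

theorem congr_right (hF : IsSortedCocycle o w0 F) {p : List C} {a b : C} {q q' : List C}
    (hw : (p ++ a :: b :: q).Perm w0) (h : q.Perm q') : F p a b q = F p a b q' := by
  suffices q.Perm q' ∧ F p a b q = F p a b q' from this.2
  refine List.Perm.adjacent_induction (P := fun x => q.Perm x ∧ F p a b q = F p a b x)
    ?_ h ⟨List.Perm.refl _, rfl⟩
  rintro x c d y ⟨h1, h2⟩
  refine ⟨h1.trans ((List.Perm.swap d c y).append_left x), h2.trans ?_⟩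
  have hw1 : (p ++ a :: b :: (x ++ c :: d :: y)).Perm w0 :=
    (((h1.cons b).cons a).append_left p).symm.trans hw
  have hsw : (p ++ a :: b :: (x ++ d :: c :: y)).Perm w0 :=
    (((((List.Perm.swap c d y).append_left x).cons b).cons a).append_left p).trans hw1
  have hs : (p ++ a :: b :: x ++ c :: d :: y).Perm w0 := by simpa using hw1
  have hs' : (p ++ b :: a :: x ++ c :: d :: y).Perm w0 :=
    (((List.Perm.swap a b x).append_left p).append_right _).trans hs
  have ht : (p ++ a :: b :: x ++ d :: c :: y).Perm w0 := by simpa using hsw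
  have ht' : (p ++ b :: a :: x ++ d :: c :: y).Perm w0 :=
    (((List.Perm.swap a b x).append_left p).append_right _).trans ht
  rcases lt_trichotomy c d with hcd | rfl | hcd
  · have := hF.far p a b x c d y hw1
    rwa [hF.asc _ _ _ _ hs hcd, hF.asc _ _ _ _ hs' hcd, one_mul, mul_one] at this
  · rfl
  · have := hF.far p a b x d c y hsw
    rw [hF.asc _ _ _ _ ht hcd, hF.asc _ _ _ _ ht' hcd, one_mul, mul_one] at this
    exact this.symm

theorem congr_left (hF : IsSortedCocycle o w0 F) {p p' : List C} {a b : C} {q : List C}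
    (hw : (p ++ a :: b :: q).Perm w0) (h : p.Perm p') : F p a b q = F p' a b q := by
  suffices p.Perm p' ∧ F p a b q = F p' a b q from this.2
  refine List.Perm.adjacent_induction (P := fun x => p.Perm x ∧ F p a b q = F x a b q)
    ?_ h ⟨List.Perm.refl _, rfl⟩
  rintro x c d y ⟨h1, h2⟩
  refine ⟨h1.trans ((List.Perm.swap d c y).append_left x), h2.trans ?_⟩
  have hw1 : (x ++ c :: d :: y ++ a :: b :: q).Perm w0 := (h1.append_right _).symm.trans hw
  have hs : (x ++ c :: d :: (y ++ a :: b :: q)).Perm w0 := by simpa using hw1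
  have hsw : (x ++ d :: c :: (y ++ a :: b :: q)).Perm w0 :=
    ((List.Perm.swap c d _).append_left x).trans hs
  have hs' : (x ++ c :: d :: (y ++ b :: a :: q)).Perm w0 :=
    (((((List.Perm.swap a b q).append_left y).cons d).cons c).append_left x).trans hs
  have ht' : (x ++ d :: c :: (y ++ b :: a :: q)).Perm w0 :=
    ((List.Perm.swap c d _).append_left x).trans hs'
  rcases lt_trichotomy c d with hcd | rfl | hcd
  · have := hF.far x c d y a b q hs
    rw [hF.asc _ _ _ _ hs hcd, hF.asc _ _ _ _ hs' hcd, one_mul, mul_one] at this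
    exact this.symm
  · rfl
  · have := hF.far x d c y a b q hsw
    rwa [hF.asc _ _ _ _ hsw hcd, hF.asc _ _ _ _ ht' hcd, one_mul, mul_one] at this

/-- Crossings in disjoint positions commute. -/
theorem commute_far (hF : IsSortedCocycle o w0 F) {p : List C} {a b c d : C} {r : List C}
    (hw : (p ++ a :: b :: c :: d :: r).Perm w0) :
    Commute (F p a b (c :: d :: r)) (F (p ++ [a, b]) c d r) := by
  have h := hF.far p a b [] c d r hw
  have hw' : (p ++ [a, b] ++ c :: d :: r).Perm w0 := by simpa using hw
  have e1 : F (p ++ [b, a]) c d r = F (p ++ [a, b]) c d r :=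
    (hF.congr_left hw' ((List.Perm.swap b a []).append_left p)).symm
  have e2 : F p a b (d :: c :: r) = F p a b (c :: d :: r) :=
    (hF.congr_right hw (List.Perm.swap d c r)).symm
  simp only [List.nil_append] at h
  rwa [e1, e2] at h

/-- If all strands on the left can be moved to the right, the value is the one at the left end. -/
theorem eq_leftValue_of_cross (hF : IsSortedCocycle o w0 F) {a b : C} (p q : List C)
    (hw : (p ++ a :: b :: q).Perm w0)
    (h : ∀ p' w q', w ∈ p → (p' ++ a :: b :: w :: q').Perm w0 →
      F p' a b (w :: q') = F (p' ++ [w]) a b q') :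
    F p a b q = leftValue w0 F a b := by
  induction p using List.reverseRecOn generalizing q with
  | nil =>
    refine hF.congr_right hw ?_
    have h1 := (hw.erase a).erase b
    simpa using h1
  | append_singleton p w ih =>
    have hw' : (p ++ a :: b :: w :: q).Perm w0 := perm_cross_iff.mp hw
    rw [← h p w q (by simp) hw', ih _ hw']
    intro p' w' q' hm
    exact h p' w' q' (by simp [hm])

theorem self_cross (hF : IsSortedCocycle o w0 F) {p : List C} {a w : C} {q : List C}
    (hw : (p ++ a :: a :: w :: q).Perm w0) : F p a a (w :: q) = F (p ++ [w]) a a q := by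
  have h1 : (p ++ a :: w :: a :: q).Perm w0 :=
    (((List.Perm.swap a w q).cons a).append_left p).trans hw
  have h2 : (p ++ w :: a :: a :: q).Perm w0 := ((List.Perm.swap a w _).append_left p).trans h1
  rcases lt_trichotomy a w with h | rfl | h
  · have := hF.braid p a a w q hw
    rwa [hF.asc p a w _ h1 h, hF.asc (p ++ [a]) a w q (by simpa using hw) h, mul_one, mul_one,
      one_mul, one_mul] at this
  · exact hF.eq_of_braid _ _ (hF.braid p a a a q hw)
  · have := hF.braid p w a a q h2
    rwa [hF.asc p w a _ h2 h, hF.asc (p ++ [a]) w a q (by simpa using h1) h, mul_one, mul_one,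
      one_mul, mul_one] at this

/-- Strands of equal colour cross with the same value wherever they are. -/
theorem self_eq (hF : IsSortedCocycle o w0 F) {p : List C} {a : C} {q : List C}
    (hw : (p ++ a :: a :: q).Perm w0) : F p a a q = leftValue w0 F a a :=
  hF.eq_leftValue_of_cross p q hw fun _ _ _ _ h => hF.self_cross h

theorem exists_perm_cons_cons {d : C} {l : List C} (h : 2 ≤ l.count d) :
    ∃ l', l.Perm (d :: d :: l') := by
  have h1 : d ∈ l := List.count_pos_iff.mp (by omega)
  have h2 : d ∈ l.erase d := List.count_pos_iff.mp (by rw [List.count_erase_self]; omega)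
  exact ⟨_, (List.perm_cons_erase h1).trans ((List.perm_cons_erase h2).cons d)⟩

theorem commute_self_of_count_right (hF : IsSortedCocycle o w0 F) {p : List C} {v u d : C}
    {q : List C} (hw : (p ++ v :: u :: q).Perm w0) (h : 2 ≤ q.count d) :
    Commute (F p v u q) (leftValue w0 F d d) := by
  obtain ⟨q', hq⟩ := exists_perm_cons_cons h
  have hw' : (p ++ v :: u :: d :: d :: q').Perm w0 :=
    (((hq.cons u).cons v).append_left p).symm.trans hw
  rw [hF.congr_right hw hq, ← hF.self_eq (p := p ++ [v, u]) (q := q') (by simpa using hw')]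
  exact hF.commute_far hw'

theorem commute_self_of_count_left (hF : IsSortedCocycle o w0 F) {p : List C} {v u d : C}
    {q : List C} (hw : (p ++ v :: u :: q).Perm w0) (h : 2 ≤ p.count d) :
    Commute (F p v u q) (leftValue w0 F d d) := by
  obtain ⟨p', hp⟩ := exists_perm_cons_cons h
  have hp' : p.Perm (p' ++ [d, d]) := hp.trans (List.perm_append_comm (l₁ := [d, d]))
  have hw' : (p' ++ d :: d :: v :: u :: q).Perm w0 := by
    simpa using (hp'.append_right (v :: u :: q)).symm.trans hw
  rw [hF.congr_left hw hp', ← hF.self_eq hw']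
  exact (hF.commute_far hw').symm

/-- Moving a strand of colour `v` across a crossing of colours `u < v` conjugates the value by the
crossing inside the block `v`. -/
theorem swap_upper (hF : IsSortedCocycle o w0 F) {p : List C} {v u : C} {q : List C} (huv : u < v)
    (hw : (p ++ v :: u :: v :: q).Perm w0) :
    F p v u (v :: q) * leftValue w0 F v v = leftValue w0 F v v * F (p ++ [v]) v u q := by
  have h1 : (p ++ u :: v :: v :: q).Perm w0 := ((List.Perm.swap v u _).append_left p).trans hw
  have h2 : (p ++ v :: v :: u :: q).Perm w0 :=
    (((List.Perm.swap u v q).cons v).append_left p).trans hw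
  have := hF.braid p v u v q hw
  rwa [hF.asc p u v _ h1 huv, hF.asc (p ++ [v]) u v _ (by simpa using hw) huv, mul_one, one_mul,
    hF.self_eq h2, hF.self_eq (p := p ++ [u]) (by simpa using h1)] at this

/-- Moving a strand of colour `u` across a crossing of colours `u < v` conjugates the value by the
crossing inside the block `u`. -/
theorem swap_lower (hF : IsSortedCocycle o w0 F) {p : List C} {v u : C} {q : List C} (huv : u < v)
    (hw : (p ++ v :: u :: u :: q).Perm w0) :
    leftValue w0 F u u * F p v u (u :: q) = F (p ++ [u]) v u q * leftValue w0 F u u := by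
  have h1 : (p ++ u :: v :: u :: q).Perm w0 := ((List.Perm.swap v u _).append_left p).trans hw
  have h2 : (p ++ u :: u :: v :: q).Perm w0 :=
    (((List.Perm.swap v u q).cons u).append_left p).trans h1
  have := hF.braid p u v u q h1
  rwa [hF.asc p u v _ h1 huv, hF.asc (p ++ [u]) u v _ (by simpa using h2) huv, mul_one, one_mul,
    hF.self_eq h2, hF.self_eq (p := p ++ [v]) (by simpa using hw)] at this

/-- The crossings inside a block of size at least three commute with the crossings of strands of
different colours: two strands of that block can be moved together, away from the crossing. -/
theorem commute_self (hF : IsSortedCocycle o w0 F) {p : List C} {v u d : C} {q : List C}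
    (huv : u < v) (hd : d ≠ o) (hw : (p ++ v :: u :: q).Perm w0) :
    Commute (F p v u q) (leftValue w0 F d d) := by
  by_cases hq : 2 ≤ q.count d
  · exact hF.commute_self_of_count_right hw hq
  by_cases hp : 2 ≤ p.count d
  · exact hF.commute_self_of_count_left hw hp
  have hc := hF.count_ne d hd
  rw [← hw.count_eq] at hc
  simp only [List.count_append, List.count_cons] at hc
  have hq1 : d ∈ q := by
    apply List.count_pos_iff.mp
    by_contra h0
    grind
  obtain ⟨q', hq'⟩ : ∃ q', q.Perm (d :: q') := ⟨_, List.perm_cons_erase hq1⟩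
  have hw' : (p ++ v :: u :: d :: q').Perm w0 :=
    (((hq'.cons u).cons v).append_left p).symm.trans hw
  have hp1 : 2 ≤ (p ++ [d]).count d := by
    rw [List.count_append, List.count_singleton_self]
    by_contra h0
    grind
  have hd' : (p ++ [d] ++ v :: u :: q').Perm w0 := perm_cross_iff.mpr hw'
  have hcomm := hF.commute_self_of_count_left hd' hp1
  rw [hF.congr_right hw hq']
  rcases eq_or_ne v d with rfl | hv
  · have h := hF.swap_upper huv hw'
    rw [← hcomm.eq] at h
    rw [mul_right_cancel h]
    exact hcomm
  · rcases eq_or_ne u d with rfl | hu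
    · have h := hF.swap_lower huv hw'
      rw [hcomm.eq] at h
      rw [mul_left_cancel h]
      exact hcomm
    · exfalso
      grind

theorem cross_of_not_between (hF : IsSortedCocycle o w0 F) {p : List C} {v u w : C} {q : List C}
    (huv : u < v) (ho : u ≠ o ∨ w ≠ o) (hb : ¬ (u < w ∧ w < v))
    (hw : (p ++ v :: u :: w :: q).Perm w0) : F p v u (w :: q) = F (p ++ [w]) v u q := by
  have h1 : (p ++ v :: w :: u :: q).Perm w0 :=
    (((List.Perm.swap u w q).cons v).append_left p).trans hw
  have h2 : (p ++ w :: v :: u :: q).Perm w0 := ((List.Perm.swap v w _).append_left p).trans h1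
  have h3 : (p ++ w :: u :: v :: q).Perm w0 :=
    (((List.Perm.swap v u q).cons w).append_left p).trans h2
  have h4 : (p ++ u :: v :: w :: q).Perm w0 := ((List.Perm.swap v u _).append_left p).trans hw
  have h5 : (p ++ u :: w :: v :: q).Perm w0 := ((List.Perm.swap w u _).append_left p).trans h3
  have hvo : v ≠ o := fun h => absurd (hF.bot u) (not_le.mpr (h ▸ huv))
  rcases lt_trichotomy w u with h | rfl | h
  · have := hF.braid p w v u q h2
    rwa [hF.asc p w v _ h2 (h.trans huv), hF.asc (p ++ [v]) w u q (by simpa using h1) h,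
      hF.asc p w u _ h3 h, hF.asc (p ++ [u]) w v q (by simpa using h5) (h.trans huv), mul_one,
      mul_one, one_mul, mul_one] at this
  · have h := hF.swap_lower huv hw
    have hc := hF.commute_self huv (d := w) (by tauto) hw
    rw [← hc.eq] at h
    exact mul_right_cancel h
  · rcases lt_trichotomy w v with h' | rfl | h'
    · exact absurd ⟨h, h'⟩ hb
    · have h := hF.swap_upper huv hw
      have hc := hF.commute_self huv hvo hw
      rw [hc.eq] at h
      exact mul_left_cancel h
    · have := hF.braid p v u w q hw
      rwa [hF.asc (p ++ [u]) v w _ (by simpa using h4) h', hF.asc p u w _ h5 h,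
        hF.asc (p ++ [v]) u w q (by simpa using hw) h, hF.asc p v w _ h1 h', mul_one,
        mul_one, one_mul, one_mul] at this

/-- A strand of colour `w` can be moved across a crossing of strands of colours `u < v` without
changing the value, unless `u` and `w` are both the least colour. If `u < w < v`, this changes the
value by conjugation with a crossing of colours `w` and `v`, which commutes with it because a
further strand of colour `v` allows one to separate both crossings. -/
theorem cross (hF : IsSortedCocycle o w0 F) {p : List C} {v u w : C} {q : List C}
    (huv : u < v) (ho : u ≠ o ∨ w ≠ o) (hw : (p ++ v :: u :: w :: q).Perm w0) :
    F p v u (w :: q) = F (p ++ [w]) v u q := by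
  by_cases hb : u < w ∧ w < v
  swap
  · exact hF.cross_of_not_between huv ho hb hw
  obtain ⟨h, h'⟩ := hb
  have h1 : (p ++ v :: w :: u :: q).Perm w0 :=
    (((List.Perm.swap u w q).cons v).append_left p).trans hw
  have h4 : (p ++ u :: v :: w :: q).Perm w0 := ((List.Perm.swap v u _).append_left p).trans hw
  have h5 : (p ++ u :: w :: v :: q).Perm w0 :=
    (((List.Perm.swap v w _).cons u).append_left p).trans h4
  have hvo : v ≠ o := fun h => absurd (hF.bot u) (not_le.mpr (h ▸ huv))
  have hwo : w ≠ o := fun e => absurd (hF.bot u) (not_le.mpr (e ▸ h))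
  have hZ : F p v w (u :: q) = F (p ++ [u]) v w q :=
    hF.cross_of_not_between h' (Or.inl hwo) (fun e => lt_asymm h e.1) h1
  have hr := hF.braid p v u w q hw
  rw [hF.asc p u w _ h5 h, hF.asc (p ++ [v]) u w q (by simpa using hw) h, mul_one, one_mul, hZ]
    at hr
  suffices hc : Commute (F p v u (w :: q)) (F (p ++ [u]) v w q) by
    rw [hc.eq] at hr
    exact mul_left_cancel hr
  have hcv := hF.count_ne v hvo
  rw [← hw.count_eq] at hcv
  simp only [List.count_append, List.count_cons] at hcv
  have hor : v ∈ q ∨ v ∈ p := by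
    by_contra hn
    rw [not_or] at hn
    rw [List.count_eq_zero_of_not_mem hn.1, List.count_eq_zero_of_not_mem hn.2] at hcv
    simp [huv.ne, h'.ne] at hcv
  rcases hor with hv | hv
  · have hq := List.perm_cons_erase hv
    set q' := q.erase v
    have hw' : (p ++ v :: u :: v :: w :: q').Perm w0 :=
      (((((List.Perm.swap w v q').trans (hq.cons w).symm).cons u).cons v).append_left p).trans hw
    have e1 : F p v u (w :: q) = F p v u (v :: w :: q') :=
      hF.congr_right hw ((hq.cons w).trans (List.Perm.swap v w q'))
    have hw2 : (p ++ [u, v] ++ v :: w :: q').Perm w0 :=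
      (((List.Perm.swap v u []).append_left p).append_right _).trans (by simpa using hw')
    have hw3 : (p ++ [u] ++ v :: w :: v :: q').Perm w0 := by
      refine List.Perm.trans ?_ hw2
      rw [List.append_assoc, List.append_assoc]
      refine List.Perm.append_left p ?_
      exact ((List.Perm.swap v w q').cons v).cons u
    have e2 : F (p ++ [v, u]) v w q' = F (p ++ [u]) v w q := by
      rw [hF.congr_left (p' := p ++ [u, v]) (by simpa using hw')
        ((List.Perm.swap u v []).append_left p),
        hF.congr_right (p := p ++ [u]) (by simpa using h4) hq,
        hF.cross_of_not_between h' (Or.inl hwo) (fun e => lt_irrefl _ e.2) hw3]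
      simp
    rw [e1, ← e2]
    exact hF.commute_far hw'
  · have hp : p.Perm (p.erase v ++ [v]) :=
      (List.perm_cons_erase hv).trans (List.perm_append_comm (l₁ := [v]))
    set p' := p.erase v
    have hw' : (p' ++ v :: u :: v :: w :: q).Perm w0 := by
      refine List.Perm.trans ?_ hw
      refine List.Perm.trans ?_ (hp.symm.append_right _)
      rw [List.append_assoc]
      exact ((List.Perm.swap v u _).cons v).append_left p'
    have e1 : F p v u (w :: q) = F p' v u (v :: w :: q) := by
      rw [hF.congr_left hw hp]
      exact (hF.cross_of_not_between huv (Or.inr hvo) (fun e => lt_irrefl _ e.2) hw').symm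
    have e2 : F (p ++ [u]) v w q = F (p' ++ [v, u]) v w q :=
      hF.congr_left (by simpa using h4) (by simpa using hp.append_right [u])
    rw [e1, e2]
    exact hF.commute_far hw'

/-! ### The values of a sorted cocycle -/

theorem desc_eq (hF : IsSortedCocycle o w0 F) {p : List C} {v u : C} {q : List C} (huv : u < v)
    (hu : u ≠ o) (hw : (p ++ v :: u :: q).Perm w0) : F p v u q = leftValue w0 F v u :=
  hF.eq_leftValue_of_cross p q hw fun _ _ _ _ h => hF.cross huv (Or.inl hu) h

theorem desc_bot_eq_of_notMem (hF : IsSortedCocycle o w0 F) {p : List C} {v : C} {q : List C}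
    (hv : o < v) (hp : o ∉ p) (hw : (p ++ v :: o :: q).Perm w0) :
    F p v o q = leftValue w0 F v o :=
  hF.eq_leftValue_of_cross p q hw fun _ _ _ hm h =>
    hF.cross hv (Or.inr fun e => hp (e ▸ hm)) h

/-- A crossing with the second strand of the least colour is conjugate to one with the first, by the
crossing of these two strands. -/
theorem desc_bot_eq_of_mem (hF : IsSortedCocycle o w0 F) {p : List C} {v : C} {q : List C}
    (hv : o < v) (hp : o ∈ p) (hw : (p ++ v :: o :: q).Perm w0) :
    F p v o q = leftValue w0 F o o * leftValue w0 F v o * (leftValue w0 F o o)⁻¹ := by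
  have hp' : p.Perm (p.erase o ++ [o]) :=
    (List.perm_cons_erase hp).trans (List.perm_append_comm (l₁ := [o]))
  set p' := p.erase o
  have hw' : (p' ++ v :: o :: o :: q).Perm w0 := by
    refine List.Perm.trans ?_ ((hp'.append_right _).symm.trans hw)
    rw [List.append_assoc]
    exact (List.Perm.swap o v _).append_left p'
  have hno : o ∉ p' := by
    intro hm
    have := hF.count_bot
    rw [← hw'.count_eq] at this
    have h1 := List.count_pos_iff.mpr hm
    simp only [List.count_append, List.count_cons, beq_self_eq_true, if_true] at this
    omega
  rw [hF.congr_left hw hp', eq_mul_inv_iff_mul_eq, ← hF.swap_lower hv hw',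
    hF.desc_bot_eq_of_notMem hv hno hw']

theorem exists_perm_append (hF : IsSortedCocycle o w0 F) (L : List C)
    (h : ∀ x, L.count x ≤ 2) : ∃ r, (L ++ r).Perm w0 := by
  refine exists_append_perm_of_count_le fun c => (h c).trans ?_
  rcases eq_or_ne c o with rfl | h
  · exact hF.count_bot.ge
  · have := hF.count_ne c h
    omega

theorem commute_self_self (hF : IsSortedCocycle o w0 F) (a d : C) :
    Commute (leftValue w0 F a a) (leftValue w0 F d d) := by
  rcases eq_or_ne a d with rfl | h
  · exact Commute.refl _
  obtain ⟨r, hr⟩ := hF.exists_perm_append [a, a, d, d] (by grind)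
  simp only [List.cons_append, List.nil_append] at hr
  have := hF.commute_far (p := []) hr
  rwa [hF.self_eq (p := []) hr, hF.self_eq (p := [] ++ [a, a]) hr] at this

theorem leftValue_self_central (hF : IsSortedCocycle o w0 F) {d : C} (hd : d ≠ o) {p : List C}
    {a b : C} {q : List C} (hw : (p ++ a :: b :: q).Perm w0) :
    Commute (leftValue w0 F d d) (F p a b q) := by
  rcases lt_trichotomy a b with h | rfl | h
  · rw [hF.asc p a b q hw h]
    exact Commute.one_right _
  · rw [hF.self_eq hw]
    exact hF.commute_self_self _ _
  · exact (hF.commute_self h hd hw).symm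

theorem leftValue_desc_central (hF : IsSortedCocycle o w0 F) {v u : C} (huv : u < v) (hu : u ≠ o)
    {p : List C} {a b : C} {q : List C} (hw : (p ++ a :: b :: q).Perm w0) :
    Commute (leftValue w0 F v u) (F p a b q) := by
  have hvo : v ≠ o := fun h => absurd (hF.bot u) (not_le.mpr (h ▸ huv))
  rcases lt_trichotomy a b with h | rfl | h
  · rw [hF.asc p a b q hw h]
    exact Commute.one_right _
  · rw [hF.self_eq hw]
    rcases eq_or_ne a o with rfl | ha
    · obtain ⟨r, hr⟩ := hF.exists_perm_append [v, u, a, a] (by grind)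
      simp only [List.cons_append, List.nil_append] at hr
      have := hF.commute_far (p := []) hr
      rwa [hF.desc_eq (p := []) huv hu hr, hF.self_eq (p := [] ++ [v, u]) hr] at this
    · obtain ⟨r, hr⟩ := hF.exists_perm_append [v, u] (by grind)
      simp only [List.cons_append, List.nil_append] at hr
      have := hF.commute_self (p := []) huv ha hr
      rwa [hF.desc_eq (p := []) huv hu hr] at this
  · have hao : a ≠ o := fun e => absurd (hF.bot b) (not_le.mpr (e ▸ h))
    by_cases hc : b = o ∧ o ∈ p
    · obtain ⟨rfl, hp⟩ := hc
      obtain ⟨r, hr⟩ := hF.exists_perm_append [b, v, u, a, b] (by grind)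
      simp only [List.cons_append, List.nil_append] at hr
      have := hF.commute_far (p := [b]) hr
      rw [hF.desc_eq (p := [b]) huv hu hr,
        hF.desc_bot_eq_of_mem (p := [b] ++ [v, u]) h (by simp) hr] at this
      rwa [hF.desc_bot_eq_of_mem h hp hw]
    · obtain ⟨r, hr⟩ := hF.exists_perm_append [v, u, a, b] (by grind)
      simp only [List.cons_append, List.nil_append] at hr
      have := hF.commute_far (p := []) hr
      rw [hF.desc_eq (p := []) huv hu hr] at this
      rcases eq_or_ne b o with rfl | hb
      · rw [hF.desc_bot_eq_of_notMem (p := [] ++ [v, u]) h (by simp [hu.symm, hvo.symm]) hr] at this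
        rwa [hF.desc_bot_eq_of_notMem h (by tauto) hw]
      · rw [hF.desc_eq (p := [] ++ [v, u]) h hb hr] at this
        rwa [hF.desc_eq h hb hw]

/-- Full twists of different strands of the smallest block with other blocks commute. -/
theorem commute_desc_conj (hF : IsSortedCocycle o w0 F) {v w : C} (hv : o < v) (hw : o < w) :
    Commute (leftValue w0 F v o)
      (leftValue w0 F o o * leftValue w0 F w o * (leftValue w0 F o o)⁻¹) := by
  obtain ⟨r, hr⟩ := hF.exists_perm_append [v, o, w, o] (by grind)
  simp only [List.cons_append, List.nil_append] at hr
  have := hF.commute_far (p := []) hr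
  rwa [hF.desc_bot_eq_of_notMem (p := []) hv (by simp) hr,
    hF.desc_bot_eq_of_mem (p := [] ++ [v, o]) hw (by simp) hr] at this

/-- Full twists of one strand of the smallest block with different blocks commute. -/
theorem commute_desc_desc (hF : IsSortedCocycle o w0 F) {v w : C} (hv : o < v) (hw : o < w) :
    Commute (leftValue w0 F v o) (leftValue w0 F w o) := by
  wlog hwv : w < v generalizing v w
  · rcases eq_or_lt_of_le (not_lt.mp hwv) with rfl | h
    · exact Commute.refl _
    · exact (this hw hv h).symm
  obtain ⟨r, hr⟩ := hF.exists_perm_append [v, w, o] (by grind)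
  simp only [List.cons_append, List.nil_append] at hr
  have h1 : ([] ++ w :: v :: o :: r).Perm w0 := (List.Perm.swap v w _).trans hr
  have h2 : ([] ++ w :: o :: v :: r).Perm w0 := ((List.Perm.swap v o _).cons w).trans h1
  have h3 : ([] ++ v :: o :: w :: r).Perm w0 := ((List.Perm.swap w o _).cons v).trans hr
  have h4 : ([o] ++ v :: w :: r).Perm w0 := (List.Perm.swap v o _).trans h3
  have hb := hF.braid [] v w o r hr
  have hZ := hF.leftValue_desc_central hwv hw.ne' h3
  rw [hF.desc_bot_eq_of_notMem (p := []) hv (by simp) h3] at hZ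
  have hZ' := hF.leftValue_desc_central hwv hw.ne' h2
  rw [hF.desc_bot_eq_of_notMem (p := []) hw (by simp) h2] at hZ'
  simp only [List.nil_append] at hb
  rw [hF.desc_eq (p := []) hwv hw.ne' hr, hF.desc_eq (p := [o]) hwv hw.ne' h4,
    hF.desc_bot_eq_of_notMem (p := [w]) hv (by simp [hw.ne]) h1,
    hF.desc_bot_eq_of_notMem (p := []) hw (by simp) h2,
    hF.desc_bot_eq_of_notMem (p := [v]) hw (by simp [hv.ne]) hr,
    hF.desc_bot_eq_of_notMem (p := []) hv (by simp) h3, mul_assoc,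
    (hZ.mul_right hZ').eq] at hb
  exact mul_right_cancel hb

/-- The square of the crossing in the smallest block commutes with full twists. -/
theorem conj_conj_desc (hF : IsSortedCocycle o w0 F) {v : C} (hv : o < v) :
    leftValue w0 F o o * (leftValue w0 F o o * leftValue w0 F v o * (leftValue w0 F o o)⁻¹) =
      leftValue w0 F v o * leftValue w0 F o o := by
  obtain ⟨r, hr⟩ := hF.exists_perm_append [v, o, o] (by grind)
  simp only [List.cons_append, List.nil_append] at hr
  have h1 : ([o] ++ v :: o :: r).Perm w0 := (List.Perm.swap v o _).trans hr
  have h2 : ([] ++ o :: o :: v :: r).Perm w0 := ((List.Perm.swap v o _).cons o).trans h1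
  have hb := hF.braid [] v o o r hr
  simp only [List.nil_append] at hb
  rw [hF.desc_bot_eq_of_notMem (p := []) hv (by simp) hr,
    hF.desc_bot_eq_of_mem (p := [o]) hv (by simp) h1, hF.self_eq (p := []) h2,
    hF.self_eq (p := [v]) hr, (hF.commute_desc_conj hv hv).eq] at hb
  set S := leftValue w0 F o o
  set A := leftValue w0 F v o
  have : S * A * S⁻¹ * (A * S) = S * A * S⁻¹ * (S * (S * A * S⁻¹)) := by
    rw [← mul_assoc, hb]
    group
  exact (mul_left_cancel this).symm

end IsSortedCocycle

/-! ### The explicit group -/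

/-- The group `(ℤ² / a • Δ̄)^m ⋊ ℤ`. -/
abbrev SwapGroup (a m : ℕ) : Type :=
  Multiplicative (Fin m → SqMod a) ⋊[swapAction a m] Multiplicative ℤ

/-- The group to which the quotient of `B_{2,k,n}` by a term of its lower central series is
isomorphic. The free abelian factor records the total linking number of each pair of different
blocks among those of size at least three, and the exponent sum of the crossings inside each of
these blocks; the latter corresponds to the diagonal of `Sym2`. -/
abbrev LinkGroup (a l : ℕ) : Type :=
  Multiplicative (Sym2 (Fin (l + 1)) → ℤ) × SwapGroup a (l + 1)

theorem swapMod_mk (a : ℕ) (x y : ℤ) :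
    swapMod a (QuotientAddGroup.mk (x, y)) = QuotientAddGroup.mk (y, x) := rfl

theorem swapAction_one_apply (a m : ℕ) (v : Multiplicative (Fin m → SqMod a)) (i : Fin m) :
    (swapAction a m (Multiplicative.ofAdd 1) v).toAdd i = swapMod a (v.toAdd i) := by
  rw [swapAction, zpowersHom_apply]
  simp

/-- The generator that counts full twists of one strand of the block of size two with the block `i`:
of its second strand if `second` holds, and of its first strand otherwise. -/
def twist (a : ℕ) {m : ℕ} (i : Fin m) (second : Prop) [Decidable second] :
    Multiplicative (Fin m → SqMod a) :=
  .ofAdd (Pi.single i (QuotientAddGroup.mk (if second then (0, 1) else (1, 0))))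

theorem swapAction_twist (a : ℕ) {m : ℕ} (i : Fin m) (P Q : Prop) [Decidable P] [Decidable Q]
    (h : P ↔ ¬ Q) : swapAction a m (.ofAdd 1) (twist a i P) = twist a i Q := by
  apply Multiplicative.toAdd.injective
  funext j
  rw [swapAction_one_apply]
  simp only [twist, toAdd_ofAdd, h]
  rcases eq_or_ne j i with rfl | hj
  · rw [Pi.single_eq_same, Pi.single_eq_same]
    by_cases hQ : Q <;> simp only [hQ, not_true, not_false_iff, if_true, if_false, swapMod_mk]
  · rw [Pi.single_eq_of_ne hj, Pi.single_eq_of_ne hj, map_zero]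

theorem inr_mul_inl_twist (a : ℕ) {m : ℕ} (i : Fin m) (P Q : Prop) [Decidable P] [Decidable Q]
    (h : P ↔ ¬ Q) :
    (SemidirectProduct.inr (.ofAdd 1) * SemidirectProduct.inl (twist a i P) : SwapGroup a m) =
      SemidirectProduct.inl (twist a i Q) * SemidirectProduct.inr (.ofAdd 1) := by
  rw [← swapAction_twist a i P Q h, SemidirectProduct.inl_aut, mul_assoc,
    ← map_mul SemidirectProduct.inr, inv_mul_cancel, map_one SemidirectProduct.inr, mul_one]

theorem closure_twist (a m : ℕ) (R : Subgroup (Multiplicative (Fin m → SqMod a)))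
    (h1 : ∀ i, twist a i False ∈ R) (h2 : ∀ i, twist a i True ∈ R) : R = ⊤ := by
  rw [eq_top_iff]
  rintro v -
  have hv : v = ∏ i, Multiplicative.ofAdd (Pi.single i (v.toAdd i)) := by
    rw [← ofAdd_sum, Finset.univ_sum_single, ofAdd_toAdd]
  rw [hv]
  refine Subgroup.prod_mem _ fun i _ => ?_
  obtain ⟨⟨x, y⟩, hxy⟩ := QuotientAddGroup.mk_surjective (v.toAdd i)
  have : Multiplicative.ofAdd (Pi.single i (v.toAdd i)) =
      (twist a i False) ^ x * (twist a i True) ^ y := by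
    simp only [twist, if_true, if_false]
    rw [← ofAdd_zsmul, ← ofAdd_zsmul, ← ofAdd_add, ← Pi.single_zsmul, ← Pi.single_zsmul,
      ← Pi.single_add, ← hxy, ← QuotientAddGroup.mk_zsmul, ← QuotientAddGroup.mk_zsmul,
      ← QuotientAddGroup.mk_add]
    simp
  rw [this]
  exact mul_mem (zpow_mem (h1 i) x) (zpow_mem (h2 i) y)

theorem eq_top_of_generators_mem (a l : ℕ) (R : Subgroup (LinkGroup a l))
    (h0 : ∀ z, ((.ofAdd (Pi.single z 1), 1) : LinkGroup a l) ∈ R)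
    (h1 : ((1, SemidirectProduct.inr (.ofAdd 1)) : LinkGroup a l) ∈ R)
    (h2 : ∀ i, ((1, SemidirectProduct.inl (twist a i False)) : LinkGroup a l) ∈ R) : R = ⊤ := by
  have h3 : ∀ i, ((1, SemidirectProduct.inl (twist a i True)) : LinkGroup a l) ∈ R := by
    intro i
    have h := inr_mul_inl_twist a i False True (by simp)
    rw [eq_mul_inv_of_mul_eq h.symm]
    have := mul_mem (mul_mem h1 (h2 i)) (inv_mem h1)
    simpa using this
  rw [eq_top_iff]
  rintro ⟨z, v⟩ -
  have e : ((z, v) : LinkGroup a l) = (z, 1) * ((1, SemidirectProduct.inl v.left) *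
      (1, SemidirectProduct.inr v.right)) := by
    simp
  rw [e]
  refine mul_mem ?_ (mul_mem ?_ ?_)
  · have hz : z = ∏ i, Multiplicative.ofAdd (Pi.single i (1 : ℤ)) ^ (z.toAdd i) := by
      apply Multiplicative.toAdd.injective
      rw [toAdd_prod]
      simp only [toAdd_zpow, toAdd_ofAdd, ← Pi.single_zsmul, smul_eq_mul, mul_one,
        Finset.univ_sum_single]
    have h : z ∈ R.comap (MonoidHom.inl _ (SwapGroup a (l + 1))) := by
      rw [hz]
      refine Subgroup.prod_mem _ fun i _ => zpow_mem ?_ _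
      exact h0 i
    exact h
  · let R' : Subgroup (Multiplicative (Fin (l + 1) → SqMod a)) :=
      R.comap ((MonoidHom.inr (Multiplicative (Sym2 (Fin (l + 1)) → ℤ)) (SwapGroup a (l + 1))).comp
        SemidirectProduct.inl)
    have h : R' = ⊤ := closure_twist a (l + 1) R' h2 h3
    have hv : v.left ∈ R' := h ▸ Subgroup.mem_top _
    exact hv
  · have : ((1, SemidirectProduct.inr v.right) : LinkGroup a l) =
        (1, SemidirectProduct.inr (.ofAdd 1)) ^ (v.right.toAdd) := by
      rw [Prod.pow_mk, one_zpow, ← map_zpow, ← ofAdd_zsmul]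
      simp
    rw [this]
    exact zpow_mem h1 _

/-! ### Homomorphisms out of the explicit group -/

theorem exists_hom_of_commGroup {H : Type*} [CommGroup H] (a : ℕ) {m : ℕ} (A B : Fin m → H)
    (hd : ∀ i, (A i * (B i)⁻¹) ^ a = 1) :
    ∃ f : Multiplicative (Fin m → SqMod a) →* H,
      (∀ i, f (twist a i False) = A i) ∧ ∀ i, f (twist a i True) = B i := by
  let A' : Fin m → Additive H := fun i => .ofMul (A i)
  let B' : Fin m → Additive H := fun i => .ofMul (B i)
  let g : ∀ i, SqMod a →+ Additive H := fun i =>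
    QuotientAddGroup.lift _ (AddMonoidHom.coprod (zmultiplesHom _ (A' i)) (zmultiplesHom _ (B' i)))
      (by
        rw [AddSubgroup.zmultiples_le, AddMonoidHom.mem_ker, map_nsmul]
        have : (AddMonoidHom.coprod (zmultiplesHom _ (A' i)) (zmultiplesHom _ (B' i))) (1, -1) =
            A' i - B' i := by simp [sub_eq_add_neg]
        rw [this]
        apply Additive.toMul.injective
        have := hd i
        rw [← div_eq_mul_inv] at this
        exact this)
  let f : (Fin m → SqMod a) →+ Additive H := ∑ i, (g i).comp (Pi.evalAddMonoidHom _ i)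
  have hf : ∀ i x, f (Pi.single i x) = g i x := by
    intro i x
    simp only [f, AddMonoidHom.finsetSum_apply, AddMonoidHom.comp_apply,
      Pi.evalAddMonoidHom_apply]
    rw [Finset.sum_eq_single i]
    · rw [Pi.single_eq_same]
    · intro j _ hj
      rw [Pi.single_eq_of_ne hj, map_zero]
    · simp
  refine ⟨AddMonoidHom.toMultiplicativeLeft f, fun i => ?_, fun i => ?_⟩
  · have : f (twist a i False).toAdd = A' i := by
      rw [twist, toAdd_ofAdd, hf]
      simp [g]
    exact this
  · have : f (twist a i True).toAdd = B' i := by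
      rw [twist, toAdd_ofAdd, hf]
      simp [g]
    exact this

theorem exists_hom_pi_int {H ι : Type*} [CommGroup H] [Fintype ι] [DecidableEq ι] (Z : ι → H) :
    ∃ g : Multiplicative (ι → ℤ) →* H, ∀ z, g (.ofAdd (Pi.single z 1)) = Z z := by
  refine ⟨AddMonoidHom.toMultiplicativeLeft
    (∑ z, (zmultiplesHom (Additive H) (.ofMul (Z z))).comp (Pi.evalAddMonoidHom _ z)),
    fun z => ?_⟩
  suffices (∑ z, (zmultiplesHom (Additive H) (.ofMul (Z z))).comp
      (Pi.evalAddMonoidHom (fun _ => ℤ) z)) (Pi.single z 1) = .ofMul (Z z) from this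
  simp only [AddMonoidHom.finsetSum_apply, AddMonoidHom.comp_apply,
    Pi.evalAddMonoidHom_apply, zmultiplesHom_apply]
  rw [Finset.sum_eq_single z]
  · rw [Pi.single_eq_same, one_smul]
  · intro j _ hj
    rw [Pi.single_eq_of_ne hj, zero_smul]
  · simp

open scoped IsMulCommutative in
theorem exists_hom_of_commute {Γ : Type*} [Group Γ] (a : ℕ) {m : ℕ} (A B : Fin m → Γ)
    (hA : ∀ i j, Commute (A i) (A j)) (hB : ∀ i j, Commute (B i) (B j))
    (hAB : ∀ i j, Commute (A i) (B j)) (hd : ∀ i, (A i * (B i)⁻¹) ^ a = 1) :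
    ∃ f : Multiplicative (Fin m → SqMod a) →* Γ,
      (∀ i, f (twist a i False) = A i) ∧ ∀ i, f (twist a i True) = B i := by
  have hcomm : ∀ x ∈ Set.range A ∪ Set.range B, ∀ y ∈ Set.range A ∪ Set.range B,
      x * y = y * x := by
    rintro _ (⟨i, rfl⟩ | ⟨i, rfl⟩) _ (⟨j, rfl⟩ | ⟨j, rfl⟩)
    exacts [hA i j, hAB i j, (hAB j i).symm, hB i j]
  have := Subgroup.isMulCommutative_closure hcomm
  set H := Subgroup.closure (Set.range A ∪ Set.range B)
  obtain ⟨f, hf1, hf2⟩ := exists_hom_of_commGroup (H := H) a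
    (fun i => ⟨A i, Subgroup.subset_closure (Or.inl ⟨i, rfl⟩)⟩)
    (fun i => ⟨B i, Subgroup.subset_closure (Or.inr ⟨i, rfl⟩)⟩)
    (fun i => Subtype.ext (hd i))
  exact ⟨H.subtype.comp f, fun i => congrArg Subtype.val (hf1 i),
    fun i => congrArg Subtype.val (hf2 i)⟩

open scoped IsMulCommutative in
/-- The relations by which `LinkGroup a l` is presented. -/
theorem exists_hom_linkGroup {Γ : Type*} [Group Γ] (a l : ℕ) (s : Γ) (A : Fin (l + 1) → Γ)
    (Z : Sym2 (Fin (l + 1)) → Γ) (hZ : ∀ z x, Commute (Z z) x)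
    (hA : ∀ i j, Commute (A i) (A j)) (hAB : ∀ i j, Commute (A i) (s * A j * s⁻¹))
    (hs : ∀ i, s * (s * A i * s⁻¹) = A i * s) (hd : ∀ i, (A i * (s * A i * s⁻¹)⁻¹) ^ a = 1) :
    ∃ ψ : LinkGroup a l →* Γ,
      (∀ z, ψ (.ofAdd (Pi.single z 1), 1) = Z z) ∧
      ψ (1, SemidirectProduct.inr (.ofAdd 1)) = s ∧
      (∀ i, ψ (1, SemidirectProduct.inl (twist a i False)) = A i) ∧
      ∀ i, ψ (1, SemidirectProduct.inl (twist a i True)) = s * A i * s⁻¹ := by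
  obtain ⟨f, hf1, hf2⟩ := exists_hom_of_commute a A (fun i => s * A i * s⁻¹) hA
    (fun i j => by
      have := (hA i j).map (MulAut.conj s).toMonoidHom
      simpa using this) hAB hd
  have h1 : ∀ x, f (swapAction a (l + 1) (.ofAdd 1) x) = s * f x * s⁻¹ := by
    have := closure_twist a (l + 1) (MonoidHom.eqLocus
      (f.comp (swapAction a (l + 1) (.ofAdd 1)).toMonoidHom)
      ((MulAut.conj s).toMonoidHom.comp f))
      (fun i => by
        change f _ = s * f _ * s⁻¹
        rw [MulEquiv.coe_toMonoidHom, swapAction_twist a i False True (by simp), hf1, hf2])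
      (fun i => by
        change f _ = s * f _ * s⁻¹
        rw [MulEquiv.coe_toMonoidHom, swapAction_twist a i True False (by simp), hf1, hf2, hs i]
        group)
    intro x
    exact (this ▸ Subgroup.mem_top x : x ∈ MonoidHom.eqLocus
      (f.comp (swapAction a (l + 1) (.ofAdd 1)).toMonoidHom)
      ((MulAut.conj s).toMonoidHom.comp f))
  have hn : ∀ (n : ℤ) x, f (swapAction a (l + 1) (.ofAdd n) x) = s ^ n * f x * (s ^ n)⁻¹ := by
    intro n
    induction n using Int.induction_on with
    | zero => intro x; simp
    | succ n ih =>
      intro x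
      rw [add_comm (n : ℤ) 1, ofAdd_add, map_mul, MulAut.mul_apply, h1, ih, zpow_add, zpow_one]
      group
    | pred n ih =>
      intro x
      have h2 := h1 (swapAction a (l + 1) (.ofAdd (-(n : ℤ) - 1)) x)
      rw [← MulAut.mul_apply, ← map_mul, ← ofAdd_add, add_sub_cancel, ih] at h2
      rw [zpow_sub, zpow_one, ← mul_right_inj s, ← mul_left_inj s⁻¹, ← h2]
      group
  let fS : SwapGroup a (l + 1) →* Γ := SemidirectProduct.lift f (zpowersHom Γ s) (by
    intro g
    refine MonoidHom.ext fun x => ?_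
    have := hn g.toAdd x
    rw [ofAdd_toAdd] at this
    exact this)
  obtain ⟨g, hg⟩ := exists_hom_pi_int (H := Subgroup.center Γ)
    fun z => ⟨Z z, Subgroup.mem_center_iff.mpr fun x => ((hZ z x).eq).symm⟩
  have hc : ∀ x y, Commute ((Subgroup.center Γ).subtype.comp g x) (fS y) := fun x y =>
    ((Subgroup.mem_center_iff.mp (g x).2) (fS y)).symm
  refine ⟨MonoidHom.noncommCoprod ((Subgroup.center Γ).subtype.comp g) fS hc, ?_, ?_, ?_, ?_⟩
  · intro z
    rw [MonoidHom.noncommCoprod_apply, map_one, mul_one]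
    exact congrArg Subtype.val (hg z)
  · rw [MonoidHom.noncommCoprod_apply, map_one, one_mul, SemidirectProduct.lift_inr]
    simp
  · intro i
    rw [MonoidHom.noncommCoprod_apply, map_one, one_mul, SemidirectProduct.lift_inl, hf1]
  · intro i
    rw [MonoidHom.noncommCoprod_apply, map_one, one_mul, SemidirectProduct.lift_inl, hf2]

/-! ### The lower central series of the explicit group -/

/-- The subgroup of `(ℤ² / a • Δ̄)^m` of the tuples of multiples of `2 ^ k • Δ̄`. -/
def antiDiag (a m k : ℕ) : AddSubgroup (Fin m → SqMod a) :=
  AddSubgroup.pi Set.univ fun _ =>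
    AddSubgroup.zmultiples (QuotientAddGroup.mk ((2 ^ k : ℕ) • ((1, -1) : ℤ × ℤ)))

theorem mem_antiDiag {a m k : ℕ} {v : Fin m → SqMod a} :
    v ∈ antiDiag a m k ↔ ∀ i, ∃ n : ℤ, v i = QuotientAddGroup.mk (n * 2 ^ k, -(n * 2 ^ k)) := by
  simp only [antiDiag, AddSubgroup.mem_pi, Set.mem_univ, true_imp_iff,
    AddSubgroup.mem_zmultiples_iff]
  refine forall_congr' fun i => exists_congr fun n => ?_
  rw [← QuotientAddGroup.mk_zsmul, eq_comm]
  simp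

theorem swapAction_of_mem_antiDiag {a m k : ℕ} {v : Multiplicative (Fin m → SqMod a)}
    (hv : v.toAdd ∈ antiDiag a m k) : swapAction a m (.ofAdd 1) v = v⁻¹ := by
  apply Multiplicative.toAdd.injective
  funext i
  obtain ⟨n, hn⟩ := mem_antiDiag.mp hv i
  rw [swapAction_one_apply, hn, swapMod_mk, toAdd_inv, Pi.neg_apply, hn, ← QuotientAddGroup.mk_neg]
  simp

theorem swapAction_zpow_of_mem_antiDiag {a m k : ℕ} {v : Multiplicative (Fin m → SqMod a)}
    (hv : v.toAdd ∈ antiDiag a m k) (t : Multiplicative ℤ) :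
    swapAction a m t v = v ∨ swapAction a m t v = v⁻¹ := by
  obtain ⟨n, rfl⟩ := Multiplicative.ofAdd.surjective t
  have h := swapAction_of_mem_antiDiag hv
  induction n using Int.induction_on with
  | zero => left; simp
  | succ n ih =>
    rw [add_comm, ofAdd_add, map_mul, MulAut.mul_apply]
    rcases ih with ih | ih <;> rw [ih]
    · exact Or.inr h
    · left; rw [map_inv, h, inv_inv]
  | pred n ih =>
    have h2 : swapAction a m (.ofAdd 1) (swapAction a m (.ofAdd (-(n : ℤ) - 1)) v) =
        swapAction a m (.ofAdd (-(n : ℤ))) v := by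
      rw [← MulAut.mul_apply, ← map_mul, ← ofAdd_add, add_sub_cancel]
    rcases ih with ih | ih <;> rw [ih] at h2
    · right
      apply (swapAction a m (.ofAdd 1)).injective
      rw [h2, map_inv, h, inv_inv]
    · left
      apply (swapAction a m (.ofAdd 1)).injective
      rw [h2, h]

theorem swapAction_mul_inv_mem_antiDiag {a m : ℕ} (v : Multiplicative (Fin m → SqMod a))
    (t : Multiplicative ℤ) : (v * (swapAction a m t v)⁻¹).toAdd ∈ antiDiag a m 0 := by
  obtain ⟨n, rfl⟩ := Multiplicative.ofAdd.surjective t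
  have h1 : ∀ v : Multiplicative (Fin m → SqMod a),
      (v * (swapAction a m (.ofAdd 1) v)⁻¹).toAdd ∈ antiDiag a m 0 := by
    intro v
    rw [mem_antiDiag]
    intro i
    obtain ⟨⟨x, y⟩, hxy⟩ := QuotientAddGroup.mk_surjective (v.toAdd i)
    refine ⟨x - y, ?_⟩
    rw [toAdd_mul, toAdd_inv, Pi.add_apply, Pi.neg_apply, swapAction_one_apply, ← hxy, swapMod_mk,
      ← QuotientAddGroup.mk_neg, ← QuotientAddGroup.mk_add]
    congr 1
    simp
    constructor <;> ring
  induction n using Int.induction_on with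
  | zero => simp
  | succ n ih =>
    have h2 := add_mem ih (h1 (swapAction a m (.ofAdd (n : ℤ)) v))
    rw [← toAdd_mul, ← MulAut.mul_apply, ← map_mul, ← ofAdd_add, add_comm 1] at h2
    simpa using h2
  | pred n ih =>
    have h2 := sub_mem ih (h1 (swapAction a m (.ofAdd (-(n : ℤ) - 1)) v))
    rw [← toAdd_div, ← MulAut.mul_apply, ← map_mul, ← ofAdd_add, add_sub_cancel] at h2
    rwa [div_eq_mul_inv, mul_inv, inv_inv, mul_mul_mul_comm, mul_comm v, mul_assoc,
      inv_mul_cancel, mul_one, mul_comm] at h2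

/-- The elements of `LinkGroup a l` that lie in `(ℤ² / a • Δ̄)^(l + 1)` and have multiples of
`2 ^ k • Δ̄` as components. -/
def linkSeries (a l k : ℕ) : Subgroup (LinkGroup a l) where
  carrier := {x | x.1 = 1 ∧ x.2.right = 1 ∧ x.2.left.toAdd ∈ antiDiag a (l + 1) k}
  one_mem' := ⟨rfl, rfl, zero_mem _⟩
  mul_mem' := by
    rintro x y ⟨h1, h2, h3⟩ ⟨h4, h5, h6⟩
    refine ⟨by simp [h1, h4], by simp [h2, h5], ?_⟩
    rw [Prod.snd_mul, SemidirectProduct.mul_left, h2, map_one, MulAut.one_apply, toAdd_mul]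
    exact add_mem h3 h6
  inv_mem' := by
    rintro x ⟨h1, h2, h3⟩
    refine ⟨by simp [h1], by simp [h2], ?_⟩
    rw [Prod.snd_inv, SemidirectProduct.inv_left, h2, inv_one, map_one, MulAut.one_apply, toAdd_inv]
    exact neg_mem h3

/-- The first commutators lie in the multiples of `Δ̄`; the swap inverts these, so that each further
commutator doubles them. -/
theorem lowerCentralSeries_linkGroup_le (a l k : ℕ) :
    (⊤ : Subgroup (LinkGroup a l)).lowerCentralSeries (k + 1) ≤ linkSeries a l k := by
  induction k with
  | zero =>
    rw [Subgroup.lowerCentralSeries_succ, Subgroup.commutator_le]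
    rintro ⟨z, ⟨v, s⟩⟩ - ⟨z', ⟨w, t⟩⟩ -
    refine ⟨?_, ?_, ?_⟩
    · simp [commutatorElement_def]
    · simp [commutatorElement_def]
    · have e : (⁅((z, ⟨v, s⟩) : LinkGroup a l), ((z', ⟨w, t⟩) : LinkGroup a l)⁆).2.left =
          (v * (swapAction a (l + 1) t v)⁻¹) * (w * (swapAction a (l + 1) s w)⁻¹)⁻¹ := by
        have hst : swapAction a (l + 1) (s * t) * (swapAction a (l + 1) s)⁻¹ =
            swapAction a (l + 1) t := by rw [← map_inv, ← map_mul, mul_inv_cancel_comm]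
        simp only [commutatorElement_def, Prod.snd_mul, Prod.snd_inv, SemidirectProduct.mul_left,
          SemidirectProduct.mul_right, SemidirectProduct.inv_left, SemidirectProduct.inv_right,
          ← MulAut.mul_apply, map_inv, hst]
        simp only [mul_inv_cancel_comm, mul_inv_cancel, MulAut.one_apply]
        rw [mul_inv, inv_inv]
        simp only [mul_comm, mul_assoc, mul_left_comm]
      rw [e, toAdd_mul, toAdd_inv]
      exact add_mem (swapAction_mul_inv_mem_antiDiag _ _)
        (neg_mem (swapAction_mul_inv_mem_antiDiag _ _))
  | succ k ih =>
    rw [Subgroup.lowerCentralSeries_succ, Subgroup.commutator_le]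
    rintro ⟨z, ⟨v, s⟩⟩ hx ⟨z', ⟨w, t⟩⟩ -
    obtain ⟨h1, h2, h3⟩ := ih hx
    simp only at h1 h2 h3
    subst h1 h2
    refine ⟨?_, ?_, ?_⟩
    · simp [commutatorElement_def]
    · simp [commutatorElement_def]
    · have e : (⁅((1, ⟨v, 1⟩) : LinkGroup a l), ((z', ⟨w, t⟩) : LinkGroup a l)⁆).2.left =
          v * (swapAction a (l + 1) t v)⁻¹ := by
        simp only [commutatorElement_def, Prod.snd_mul, Prod.snd_inv, SemidirectProduct.mul_left,
          SemidirectProduct.mul_right, SemidirectProduct.inv_left, SemidirectProduct.inv_right,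
          ← MulAut.mul_apply, map_inv, inv_one, mul_one, one_mul, map_one,
          MulAut.one_apply, mul_inv_cancel]
        rw [mul_right_comm, mul_assoc, mul_assoc, mul_inv_cancel_left]
      rw [e]
      rcases swapAction_zpow_of_mem_antiDiag h3 t with h | h <;> rw [h]
      · rw [mul_inv_cancel]
        exact zero_mem _
      · rw [inv_inv, toAdd_mul, mem_antiDiag]
        intro i
        obtain ⟨n, hn⟩ := mem_antiDiag.mp h3 i
        refine ⟨n, ?_⟩
        rw [Pi.add_apply, hn, ← QuotientAddGroup.mk_add]
        congr 1
        simp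
        constructor <;> ring

theorem lowerCentralSeries_linkGroup_eq_bot (l k : ℕ) :
    (⊤ : Subgroup (LinkGroup (2 ^ k) l)).lowerCentralSeries (k + 1) = ⊥ := by
  rw [eq_bot_iff]
  rintro ⟨z, ⟨v, s⟩⟩ hx
  obtain ⟨h1, h2, h3⟩ := lowerCentralSeries_linkGroup_le _ _ _ hx
  simp only at h1 h2 h3
  subst h1 h2
  have hv : v = 1 := by
    apply Multiplicative.toAdd.injective
    funext i
    obtain ⟨n, hn⟩ := mem_antiDiag.mp h3 i
    rw [hn, toAdd_one, Pi.zero_apply, QuotientAddGroup.eq_zero_iff, AddSubgroup.mem_zmultiples_iff]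
    exact ⟨n, by simp⟩
  rw [hv]
  exact Subgroup.mem_bot.mpr rfl

/-! ### The linking cocycle -/

/-- The contribution of a crossing of strands of colours `x` and `y` to the free abelian factor of
`LinkGroup a l`. Crossings of different colours count if they put the strands in order, so that
every full twist counts once. -/
def pairValue {l : ℕ} (x y : Fin (l + 2)) : Multiplicative (Sym2 (Fin (l + 1)) → ℤ) :=
  Fin.cases 1 (fun i => Fin.cases 1
    (fun j => if j ≤ i then .ofAdd (Pi.single s(i, j) 1) else 1) y) x

/-- The contribution of a crossing of strands of colours `x` and `y` after the prefix `p` to the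
factor `SwapGroup a (l + 1)`. The strands of colour `0` are numbered by their positions. -/
def swapValue (a : ℕ) {l : ℕ} (p : List (Fin (l + 2))) (x y : Fin (l + 2)) : SwapGroup a (l + 1) :=
  if y = 0 then
    Fin.cases (SemidirectProduct.inr (.ofAdd 1))
      (fun i => SemidirectProduct.inl (twist a i (0 ∈ p))) x
  else 1

/-- The cocycle that records the crossings inside the blocks and the linking of the blocks. -/
def linkCocycle (a : ℕ) {l : ℕ} (p : List (Fin (l + 2))) (x y : Fin (l + 2))
    (_ : List (Fin (l + 2))) : LinkGroup a l :=
  (pairValue x y, swapValue a p x y)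

theorem swapValue_congr (a : ℕ) {l : ℕ} {p p' : List (Fin (l + 2))} (h : 0 ∈ p ↔ 0 ∈ p')
    (x y : Fin (l + 2)) : swapValue a p x y = swapValue a p' x y := by
  simp only [swapValue, twist, h]

theorem swapValue_of_ne (a : ℕ) {l : ℕ} (p : List (Fin (l + 2))) (x : Fin (l + 2))
    {y : Fin (l + 2)} (h : y ≠ 0) : swapValue a p x y = 1 := if_neg h

theorem swapValue_zero (a : ℕ) {l : ℕ} (p : List (Fin (l + 2))) :
    swapValue a p 0 0 = SemidirectProduct.inr (.ofAdd 1) := rfl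

theorem swapValue_succ (a : ℕ) {l : ℕ} (p : List (Fin (l + 2))) (i : Fin (l + 1)) :
    swapValue a p i.succ 0 = SemidirectProduct.inl (twist a i (0 ∈ p)) := rfl

theorem swapValue_commute (a : ℕ) {l : ℕ} (p p' : List (Fin (l + 2))) {x x' : Fin (l + 2)}
    (hx : x ≠ 0) (hx' : x' ≠ 0) (y y' : Fin (l + 2)) :
    Commute (swapValue a p x y) (swapValue a p' x' y') := by
  by_cases hy : y = 0
  swap
  · rw [swapValue_of_ne a p x hy]
    exact Commute.one_left _
  by_cases hy' : y' = 0
  swap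
  · rw [swapValue_of_ne a p' x' hy']
    exact Commute.one_right _
  subst hy hy'
  obtain ⟨i, rfl⟩ := Fin.exists_succ_eq.mpr hx
  obtain ⟨j, rfl⟩ := Fin.exists_succ_eq.mpr hx'
  rw [swapValue_succ, swapValue_succ]
  exact (Commute.all _ _).map SemidirectProduct.inl

theorem swapValue_swap (a : ℕ) {l : ℕ} {p p' : List (Fin (l + 2))} {x : Fin (l + 2)}
    (hx : x ≠ 0) (h : 0 ∈ p ↔ 0 ∉ p') :
    swapValue a p 0 0 * swapValue a p x 0 = swapValue a p' x 0 * swapValue a p 0 0 := by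
  obtain ⟨i, rfl⟩ := Fin.exists_succ_eq.mpr hx
  rw [swapValue_succ, swapValue_succ, swapValue_zero]
  exact inr_mul_inl_twist a i _ _ h

theorem swapValue_far (a : ℕ) {l : ℕ} {p q r : List (Fin (l + 2))} {x y z t : Fin (l + 2)}
    (hc : (p ++ x :: y :: (q ++ z :: t :: r)).count 0 ≤ 2) :
    Commute (swapValue a p x y) (swapValue a (p ++ x :: y :: q) z t) := by
  by_cases hy : y = 0
  swap
  · rw [swapValue_of_ne a p x hy]
    exact Commute.one_left _
  by_cases ht : t = 0
  swap
  · rw [swapValue_of_ne a _ z ht]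
    exact Commute.one_right _
  subst hy ht
  simp only [List.count_append, List.count_cons, beq_self_eq_true, if_true] at hc
  refine swapValue_commute a _ _ ?_ ?_ _ _ <;> rintro rfl <;>
    simp only [beq_self_eq_true, if_true] at hc <;> omega

/-- Both strands of colour `0` pass the same strand: `e₁ e₂ t = t e₁ e₂`. -/
theorem swapValue_braid_zero_zero (a : ℕ) {l : ℕ} {p : List (Fin (l + 2))} {x : Fin (l + 2)}
    (hx : x ≠ 0) (hp : 0 ∉ p) :
    swapValue a p x 0 * swapValue a (p ++ [0]) x 0 * swapValue a p 0 0 =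
      swapValue a (p ++ [x]) 0 0 * swapValue a p x 0 * swapValue a (p ++ [0]) x 0 := by
  have h1 := swapValue_swap a (p := p) (p' := p ++ [0]) hx (by simp [hp])
  have h2 := swapValue_swap a (p := p ++ [0]) (p' := p) hx (by simp [hp])
  rw [swapValue_zero] at h1 h2 ⊢
  rw [swapValue_zero, h1, mul_assoc _ _ (swapValue a (p ++ [0]) x 0), h2, ← mul_assoc,
    (swapValue_commute a p (p ++ [0]) hx hx 0 0).eq]

theorem swapValue_braid_of_ne_of_eq (a : ℕ) {l : ℕ} {p q : List (Fin (l + 2))}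
    {x y : Fin (l + 2)} (hy : y ≠ 0) (hc : (p ++ x :: y :: 0 :: q).count 0 ≤ 2) :
    swapValue a (p ++ [y]) x 0 * swapValue a p y 0 =
      swapValue a (p ++ [x]) y 0 * swapValue a p x 0 := by
  rw [swapValue_congr a (p := p ++ [y]) (p' := p) (by simp [Ne.symm hy])]
  by_cases hx : x = 0
  · subst hx
    have hp : 0 ∉ p := by
      intro h
      have := List.count_pos_iff.mpr h
      simp only [List.count_append, List.count_cons, beq_self_eq_true, if_true] at hc
      omega
    exact swapValue_swap a hy (by simp [hp])
  · rw [swapValue_congr a (p := p ++ [x]) (p' := p) (by simp [Ne.symm hx])]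
    exact swapValue_commute a _ _ hx hy _ _

theorem swapValue_braid (a : ℕ) {l : ℕ} {p q : List (Fin (l + 2))} {x y z : Fin (l + 2)}
    (hc : (p ++ x :: y :: z :: q).count 0 ≤ 2) :
    swapValue a p x y * swapValue a (p ++ [y]) x z * swapValue a p y z =
      swapValue a (p ++ [x]) y z * swapValue a p x z * swapValue a (p ++ [z]) x y := by
  by_cases hy : y = 0 <;> by_cases hz : z = 0
  · subst hy hz
    simp only [List.count_append, List.count_cons, beq_self_eq_true, if_true] at hc
    refine swapValue_braid_zero_zero a ?_ fun h => ?_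
    · rintro rfl
      simp only [beq_self_eq_true, if_true] at hc
      omega
    · have := List.count_pos_iff.mpr h
      omega
  · subst hy
    rw [swapValue_of_ne a _ x hz, swapValue_of_ne a _ 0 hz, swapValue_of_ne a _ 0 hz,
      swapValue_of_ne a _ x hz, one_mul, one_mul, mul_one, mul_one]
    exact swapValue_congr a (by simp [Ne.symm hz]) _ _
  · subst hz
    rw [swapValue_of_ne a _ x hy, swapValue_of_ne a _ x hy, one_mul, mul_one]
    exact swapValue_braid_of_ne_of_eq a hy hc
  · simp only [swapValue_of_ne a _ _ hy, swapValue_of_ne a _ _ hz, mul_one]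

theorem isWordCocycle_linkCocycle (a : ℕ) {l : ℕ} {w0 : List (Fin (l + 2))}
    (hw0 : w0.count 0 = 2) : IsWordCocycle w0 (linkCocycle a) where
  far p x y q z t r hw := by
    refine Prod.ext (mul_comm _ _) ?_
    have h := swapValue_far a ((hw.count_eq 0).trans hw0).le
    have e : swapValue a (p ++ y :: x :: q) z t = swapValue a (p ++ x :: y :: q) z t :=
      swapValue_congr a (by simp only [List.mem_append, List.mem_cons]; tauto) z t
    change swapValue a p x y * swapValue a (p ++ y :: x :: q) z t = _
    rw [e]
    exact h
  braid p x y z q hw := by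
    refine Prod.ext ?_ (swapValue_braid a ((hw.count_eq 0).trans hw0).le)
    change pairValue x y * pairValue x z * pairValue y z =
      pairValue y z * pairValue x z * pairValue x y
    rw [mul_comm, mul_comm (pairValue x y), mul_assoc]

theorem pairValue_succ {l : ℕ} (i j : Fin (l + 1)) :
    pairValue i.succ j.succ = if j ≤ i then .ofAdd (Pi.single s(i, j) 1) else 1 := rfl

theorem linkCocycle_asc (a : ℕ) {l : ℕ} (p : List (Fin (l + 2))) {x y : Fin (l + 2)}
    (h : x < y) (q : List (Fin (l + 2))) : linkCocycle a p x y q = 1 := by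
  refine Prod.ext ?_ (swapValue_of_ne a p x (Fin.pos_of_ne_zero (by
    rintro rfl; exact absurd h (Fin.not_lt_zero x))).ne')
  obtain ⟨j, rfl⟩ := Fin.exists_succ_eq.mpr (show y ≠ 0 by
    rintro rfl; exact absurd h (Fin.not_lt_zero x))
  cases x using Fin.cases with
  | zero => rfl
  | succ i =>
    change pairValue i.succ j.succ = 1
    rw [pairValue_succ, if_neg (not_le.mpr (Fin.succ_lt_succ_iff.mp h))]

/-- The values of the linking cocycle generate. -/
theorem eq_top_of_linkCocycle_mem (a : ℕ) {l : ℕ} {w0 : List (Fin (l + 2))}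
    (hw0 : ∀ c, 2 ≤ w0.count c) (R : Subgroup (LinkGroup a l))
    (h : ∀ p x y q, (p ++ x :: y :: q).Perm w0 → linkCocycle a p x y q ∈ R) : R = ⊤ := by
  have key : ∀ x y, linkCocycle a [] x y [] ∈ R := by
    intro x y
    obtain ⟨r, hr⟩ := exists_append_perm_of_count_le (w0 := w0) (L := [x, y]) fun c =>
      (List.count_le_length (a := c) (l := [x, y])).trans (hw0 c)
    exact h [] x y r hr
  refine eq_top_of_generators_mem a l R (fun z => ?_) (key 0 0) fun i => ?_
  · induction z using Sym2.ind with
    | _ i j =>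
      wlog hij : j ≤ i generalizing i j
      · rw [Sym2.eq_swap]
        exact this j i (not_le.mp hij).le
      have := key i.succ j.succ
      rwa [linkCocycle, pairValue_succ, if_pos hij, swapValue_of_ne a _ _ (Fin.succ_ne_zero j)]
        at this
  · have := key i.succ 0
    have e : linkCocycle a [] i.succ 0 [] = (1, SemidirectProduct.inl (twist a i False)) := by
      refine Prod.ext rfl ?_
      change SemidirectProduct.inl (twist a i (0 ∈ ([] : List (Fin (l + 2))))) = _
      simp only [twist, List.not_mem_nil]
    rwa [e] at this

/-! ### Sorted cocycles in nilpotent groups factor through the linking cocycle -/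

/-- If conjugation by `s` is an involution on `x`, then `⁅x, s⁆` is inverted by `s`, hence its
powers with exponent `2 ^ k` descend in the lower central series. -/
theorem commutator_pow_mem_lowerCentralSeries {Γ : Type*} [Group Γ] {s x : Γ}
    (hs : s * (s * x * s⁻¹) = x * s) (k : ℕ) :
    (x * (s * x * s⁻¹)⁻¹) ^ 2 ^ k ∈ (⊤ : Subgroup Γ).lowerCentralSeries (k + 1) := by
  set d := x * (s * x * s⁻¹)⁻¹ with hd
  have hsd : s * d * s⁻¹ = d⁻¹ := by
    have : s * d * s⁻¹ = (s * x * s⁻¹) * (s * (s * x * s⁻¹) * s⁻¹)⁻¹ := by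
      rw [hd]; group
    rw [this, hs, hd]
    group
  induction k with
  | zero =>
    have : d ^ 2 ^ 0 = ⁅x, s⁆ := by rw [hd, commutatorElement_def]; group
    rw [this]
    exact Subgroup.commutator_mem_commutator (Subgroup.mem_top _) (Subgroup.mem_top _)
  | succ k ih =>
    have : d ^ 2 ^ (k + 1) = ⁅d ^ 2 ^ k, s⁆ := by
      rw [commutatorElement_def, mul_assoc, mul_assoc, ← mul_assoc s, ← conj_inv, ← conj_pow, hsd,
        inv_pow, inv_inv, ← pow_add, ← two_mul, pow_succ']
    rw [this]
    exact Subgroup.commutator_mem_commutator ih (Subgroup.mem_top _)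

/-- The values of a sorted cocycle satisfy the relations by which the linking group is presented, so
if they generate, the cocycle is the image of the linking cocycle under a homomorphism. -/
theorem exists_hom_of_isSortedCocycle {Γ : Type*} [Group Γ] {k l : ℕ}
    {w0 : List (Fin (l + 2))} {F : List (Fin (l + 2)) → Fin (l + 2) → Fin (l + 2) →
      List (Fin (l + 2)) → Γ} (hF : IsSortedCocycle 0 w0 F)
    (hΓ : (⊤ : Subgroup Γ).lowerCentralSeries (k + 1) = ⊥)
    (hgen : ∀ R : Subgroup Γ, (∀ p x y q, (p ++ x :: y :: q).Perm w0 → F p x y q ∈ R) → R = ⊤) :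
    ∃ ψ : LinkGroup (2 ^ k) l →* Γ, ∀ p x y q, (p ++ x :: y :: q).Perm w0 →
      ψ (linkCocycle (2 ^ k) p x y q) = F p x y q := by
  have hs := fun i : Fin (l + 1) => hF.conj_conj_desc (Fin.succ_pos i)
  have hcentral : ∀ i j : Fin (l + 1), j ≤ i → ∀ x,
      Commute (leftValue w0 F i.succ j.succ) x := by
    intro i j hij x
    have := hgen (Subgroup.centralizer {leftValue w0 F i.succ j.succ}) (by
      intro p x y q hw
      rw [Subgroup.mem_centralizer_singleton_iff]
      rcases hij.eq_or_lt with rfl | hij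
      · exact (hF.leftValue_self_central (Fin.succ_ne_zero _) hw).symm
      · exact (hF.leftValue_desc_central (Fin.succ_lt_succ_iff.mpr hij)
          (Fin.succ_ne_zero _) hw).symm)
    have hx : x ∈ Subgroup.centralizer {leftValue w0 F i.succ j.succ} :=
      this ▸ Subgroup.mem_top x
    exact (Subgroup.mem_centralizer_singleton_iff.mp hx).symm
  obtain ⟨ψ, h1, h2, h3, h4⟩ := exists_hom_linkGroup (2 ^ k) l (leftValue w0 F 0 0)
    (fun i => leftValue w0 F i.succ 0)
    (fun z => leftValue w0 F z.sup.succ z.inf.succ)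
    (fun z x => hcentral _ _ (Sym2.inf_le_sup z) x)
    (fun i j => hF.commute_desc_desc (Fin.succ_pos i) (Fin.succ_pos j))
    (fun i j => hF.commute_desc_conj (Fin.succ_pos i) (Fin.succ_pos j)) hs
    (fun i => by
      have := commutator_pow_mem_lowerCentralSeries (hs i) k
      rwa [hΓ, Subgroup.mem_bot] at this)
  refine ⟨ψ, fun p x y q hw => ?_⟩
  rcases lt_or_ge x y with hxy | hxy
  · rw [linkCocycle_asc _ _ hxy, map_one, hF.asc _ _ _ _ hw hxy]
  cases y using Fin.cases with
  | zero =>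
    cases x using Fin.cases with
    | zero =>
      rw [hF.self_eq hw, ← h2]
      rfl
    | succ i =>
      have e : linkCocycle (2 ^ k) p i.succ 0 q =
        (1, SemidirectProduct.inl (twist (2 ^ k) i (0 ∈ p))) := rfl
      rw [e]
      by_cases hp : 0 ∈ p
      · rw [hF.desc_bot_eq_of_mem (Fin.succ_pos i) hp hw, ← h4 i]
        simp only [twist, hp, if_true]
      · rw [hF.desc_bot_eq_of_notMem (Fin.succ_pos i) hp hw, ← h3 i]
        simp only [twist, hp, if_false]
  | succ j =>
    obtain ⟨i, rfl⟩ := Fin.exists_succ_eq.mpr ((Fin.succ_pos j).trans_le hxy).ne'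
    have hij : j ≤ i := Fin.succ_le_succ_iff.mp hxy
    have e : linkCocycle (2 ^ k) p i.succ j.succ q = (.ofAdd (Pi.single s(i, j) 1), 1) := by
      rw [linkCocycle, pairValue_succ, if_pos hij, swapValue_of_ne _ _ _ (Fin.succ_ne_zero j)]
    rw [e, h1, Sym2.sup_mk, Sym2.inf_mk, sup_eq_left.mpr hij, inf_eq_right.mpr hij]
    rcases hij.eq_or_lt with rfl | hij
    · exact (hF.self_eq hw).symm
    · exact (hF.desc_eq (Fin.succ_lt_succ_iff.mpr hij) (Fin.succ_ne_zero _) hw).symm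

/-! ### Braids acting on words -/

theorem exists_eq_append_cons_cons {C : Type*} {w : List C} {i : ℕ} (h : i + 1 < w.length) :
    ∃ p a b q, w = p ++ a :: b :: q ∧ p.length = i := by
  refine ⟨w.take i, w[i], w[i + 1], w.drop (i + 2), ?_, ?_⟩
  · rw [← List.drop_eq_getElem_cons, ← List.drop_eq_getElem_cons, List.take_append_drop]
  · rw [List.length_take]
    omega

namespace BraidGroup

/-- The colourings of `N` positions. -/
def Coloring (N : ℕ) (C : Type*) : Type _ := Fin N → C

/-- Permutations act on colourings by moving the positions, so that `π • c = c ∘ π⁻¹`. -/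
instance {N : ℕ} {C : Type*} : MulAction (Equiv.Perm (Fin N)) (Coloring N C) := arrowAction

namespace Coloring

variable {N : ℕ} {C : Type*}

theorem smul_apply (π : Equiv.Perm (Fin N)) (c : Coloring N C) (k : Fin N) :
    (π • c) k = c (π⁻¹ k) := rfl

/-- The colours of the positions, from left to right. -/
def word (c : Coloring N C) : List C := List.ofFn (n := N) c

theorem length_word (c : Coloring N C) : c.word.length = N := List.length_ofFn

theorem getElem?_word (c : Coloring N C) (k : Fin N) : c.word[(k : ℕ)]? = some (c k) :=
  List.getElem?_ofFn.trans (dif_pos k.2)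

theorem word_injective : Function.Injective (word : Coloring N C → List C) :=
  List.ofFn_injective

theorem perm_word_smul_iff (π : Equiv.Perm (Fin N)) (c : Coloring N C) {w0 : List C} :
    (π • c).word.Perm w0 ↔ c.word.Perm w0 := by
  have : (π • c).word.Perm c.word := (π⁻¹).ofFn_comp_perm (f := c)
  exact ⟨this.symm.trans, this.trans⟩

theorem word_adjSwap_smul {c : Coloring N C} {p : List C} {a b : C} {q : List C}
    (h : c.word = p ++ a :: b :: q) {i : Fin (N - 1)} (hi : p.length = i) :
    (adjSwap i • c).word = p ++ b :: a :: q := by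
  have hl := c.length_word
  rw [h, List.length_append, List.length_cons, List.length_cons] at hl
  apply List.ext_getElem?
  intro k
  by_cases hk : k < N
  swap
  · rw [List.getElem?_eq_none (by rw [length_word]; omega),
      List.getElem?_eq_none (by rw [List.length_append, List.length_cons, List.length_cons]; omega)]
  rw [getElem?_word (adjSwap i • c) ⟨k, hk⟩, smul_apply, adjSwap_inv, ← getElem?_word, h]
  rcases lt_trichotomy k i with h1 | h1 | h1
  · rw [adjSwap_of_ne i ⟨k, hk⟩ (Nat.ne_of_lt h1) (Nat.ne_of_lt (h1.trans (Nat.lt_succ_self _)))]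
    rw [List.getElem?_append_left (hi ▸ h1), List.getElem?_append_left (hi ▸ h1)]
  · have : (⟨k, hk⟩ : Fin N) = posL i := Fin.ext h1
    rw [this, adjSwap, Equiv.swap_apply_left, h1]
    simp [posR, ← hi]
  · rcases eq_or_ne k (i + 1) with h2 | h2
    · have : (⟨k, hk⟩ : Fin N) = posR i := Fin.ext h2
      rw [this, adjSwap, Equiv.swap_apply_right, h2]
      simp [posL, ← hi]
    · rw [adjSwap_of_ne i ⟨k, hk⟩ (Nat.ne_of_gt h1) h2]
      obtain ⟨m, rfl⟩ : ∃ m, k = p.length + (m + 2) := ⟨k - (p.length + 2), by omega⟩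
      rw [List.getElem?_append_right (Nat.le_add_right _ _),
        List.getElem?_append_right (Nat.le_add_right _ _), Nat.add_sub_cancel_left]
      rfl

end Coloring

open Coloring

/-- The value of the letter `σ_i` on the colouring `c`, for a cocycle on the rearrangements of
`w0`. It is trivial if `c` is not such a rearrangement. -/
noncomputable def letterValue {N : ℕ} {C Γ : Type*} [Group Γ] (w0 : List C)
    (F : List C → C → C → List C → Γ) (i : Fin (N - 1)) (c : Coloring N C) : Γ :=
  open Classical in
  if c.word.Perm w0 then
    F (c.word.take i) (c (posL i)) (c (posR i)) (c.word.drop (i + 2))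
  else 1

section Cocycle

variable {N : ℕ} {C Γ : Type*} [Group Γ] {w0 : List C} {F : List C → C → C → List C → Γ}

theorem letterValue_eq {i : Fin (N - 1)} {c : Coloring N C} {p : List C} {a b : C} {q : List C}
    (h : c.word = p ++ a :: b :: q) (hi : p.length = i)
    (hw : (p ++ a :: b :: q).Perm w0) : letterValue w0 F i c = F p a b q := by
  have hL : c (posL i) = a := by
    have := c.getElem?_word (posL i)
    simpa [h, posL, ← hi] using this.symm
  have hR : c (posR i) = b := by
    have := c.getElem?_word (posR i)
    simpa [h, posR, ← hi] using this.symm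
  rw [letterValue, if_pos (h ▸ hw), h, hL, hR, ← hi]
  simp

theorem letterValue_of_not_perm {i : Fin (N - 1)} {c : Coloring N C}
    (h : ¬ c.word.Perm w0) : letterValue w0 F i c = 1 := if_neg h

theorem letterValue_far (hF : IsWordCocycle w0 F) {i j : Fin (N - 1)} (hij : (i : ℕ) + 1 < j)
    (c : Coloring N C) :
    letterValue w0 F i c * letterValue w0 F j (adjSwap i • c) =
      letterValue w0 F j c * letterValue w0 F i (adjSwap j • c) := by
  by_cases hc : c.word.Perm w0
  swap
  · rw [letterValue_of_not_perm hc, letterValue_of_not_perm hc, letterValue_of_not_perm,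
      letterValue_of_not_perm]
    all_goals rwa [perm_word_smul_iff]
  obtain ⟨p, a, b, x, hx, hp⟩ := exists_eq_append_cons_cons (w := c.word) (i := i)
    (by rw [length_word]; omega)
  have hl := congrArg List.length hx
  simp only [length_word, List.length_append, List.length_cons] at hl
  obtain ⟨q, d, e, r, rfl, hq⟩ := exists_eq_append_cons_cons (w := x) (i := j - (i + 2))
    (by omega)
  have hx' : c.word = (p ++ a :: b :: q) ++ d :: e :: r := by simpa using hx
  have h1 := word_adjSwap_smul hx hp
  have hj : (p ++ a :: b :: q).length = j := by simp; omega
  have h2 := word_adjSwap_smul hx' hj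
  have h1' : (adjSwap i • c).word = (p ++ b :: a :: q) ++ d :: e :: r := by simpa using h1
  have h2' : (adjSwap j • c).word = p ++ a :: b :: (q ++ e :: d :: r) := by simpa using h2
  have hc1 := (perm_word_smul_iff (w0 := w0) (adjSwap i) c).mpr hc
  have hc2 := (perm_word_smul_iff (w0 := w0) (adjSwap j) c).mpr hc
  rw [letterValue_eq hx hp (hx ▸ hc), letterValue_eq h1' (by simp; omega) (h1' ▸ hc1),
    letterValue_eq hx' hj (hx' ▸ hc), letterValue_eq h2' hp (h2' ▸ hc2)]
  exact hF.far _ _ _ _ _ _ _ (hx ▸ hc)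

theorem letterValue_braid (hF : IsWordCocycle w0 F) {i j : Fin (N - 1)} (hij : (i : ℕ) + 1 = j)
    (c : Coloring N C) :
    letterValue w0 F i c * letterValue w0 F j (adjSwap i • c) *
        letterValue w0 F i (adjSwap j • adjSwap i • c) =
      letterValue w0 F j c * letterValue w0 F i (adjSwap j • c) *
        letterValue w0 F j (adjSwap i • adjSwap j • c) := by
  by_cases hc : c.word.Perm w0
  swap
  · rw [letterValue_of_not_perm hc, letterValue_of_not_perm hc, letterValue_of_not_perm,
      letterValue_of_not_perm, letterValue_of_not_perm, letterValue_of_not_perm]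
    all_goals simpa only [perm_word_smul_iff]
  obtain ⟨p, x, y, t, hx, hp⟩ := exists_eq_append_cons_cons (w := c.word) (i := i)
    (by rw [length_word]; omega)
  have hl := congrArg List.length hx
  simp only [length_word, List.length_append, List.length_cons] at hl
  obtain ⟨z, q, rfl⟩ : ∃ z q, t = z :: q := List.exists_cons_of_length_pos (by omega)
  have assoc : ∀ u v, p ++ u :: v = (p ++ [u]) ++ v := by simp
  have hj : ∀ u, (p ++ [u]).length = (j : ℕ) := by intro u; simp; omega
  have h1 := word_adjSwap_smul hx hp
  have h12 := word_adjSwap_smul (h1.trans (assoc _ _)) (hj y)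
  have h2 := word_adjSwap_smul (hx.trans (assoc _ _)) (hj x)
  have h21 := word_adjSwap_smul (h2.trans (assoc _ _).symm) hp
  have hc1 := (perm_word_smul_iff (w0 := w0) (adjSwap i) c).mpr hc
  have hc2 := (perm_word_smul_iff (w0 := w0) (adjSwap j) c).mpr hc
  have hc12 := (perm_word_smul_iff (w0 := w0) (adjSwap j) _).mpr hc1
  have hc21 := (perm_word_smul_iff (w0 := w0) (adjSwap i) _).mpr hc2
  have e1 := h1.trans (assoc _ _)
  have e12 := h12.trans (assoc _ _).symm
  have e2' := hx.trans (assoc _ _)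
  have e2 := h2.trans (assoc _ _).symm
  have e21 := h21.trans (assoc _ _)
  rw [letterValue_eq hx hp (hx ▸ hc), letterValue_eq e1 (hj y) (e1 ▸ hc1),
    letterValue_eq e12 hp (e12 ▸ hc12), letterValue_eq e2' (hj x) (e2' ▸ hc),
    letterValue_eq e2 hp (e2 ▸ hc2), letterValue_eq e21 (hj z) (e21 ▸ hc21)]
  exact hF.braid _ _ _ _ _ (hx ▸ hc)

/-- A cocycle on words defines a homomorphism to a wreath product. -/
noncomputable def cocycleHom (hF : IsWordCocycle w0 F) (N : ℕ) :
    BraidGroup N →* (Coloring N C → Γ) ⋊[mulAutArrow] Equiv.Perm (Fin N) :=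
  lift (fun i => ⟨letterValue w0 F i, adjSwap i⟩)
    (by
      intro i j h
      refine SemidirectProduct.ext ?_ (adjSwap_comm i j h)
      funext c
      change letterValue w0 F i c * letterValue w0 F j ((adjSwap i)⁻¹ • c) =
        letterValue w0 F j c * letterValue w0 F i ((adjSwap j)⁻¹ • c)
      rw [adjSwap_inv, adjSwap_inv]
      exact letterValue_far hF h c)
    (by
      intro i j h
      refine SemidirectProduct.ext ?_ (adjSwap_braid i j h)
      funext c
      change letterValue w0 F i c * letterValue w0 F j ((adjSwap i)⁻¹ • c) *
          letterValue w0 F i ((adjSwap i * adjSwap j)⁻¹ • c) =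
        letterValue w0 F j c * letterValue w0 F i ((adjSwap j)⁻¹ • c) *
          letterValue w0 F j ((adjSwap j * adjSwap i)⁻¹ • c)
      rw [mul_inv_rev, mul_inv_rev, adjSwap_inv, adjSwap_inv, mul_smul, mul_smul]
      exact letterValue_braid hF h c)

theorem cocycleHom_right (hF : IsWordCocycle w0 F) (β : BraidGroup N) :
    (cocycleHom hF N β).right = perm N β := by
  have : SemidirectProduct.rightHom.comp (cocycleHom hF N) = perm N := by
    apply PresentedGroup.ext
    intro i
    change (cocycleHom hF N (σ i)).right = perm N (σ i)
    simp [cocycleHom, perm]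
  exact DFunLike.congr_fun this β

/-- The value of a cocycle on a braid that starts at the colouring `c`. -/
noncomputable def braidValue (hF : IsWordCocycle w0 F) (c : Coloring N C) (β : BraidGroup N) : Γ :=
  (cocycleHom hF N β).left c

theorem braidValue_one (hF : IsWordCocycle w0 F) (c : Coloring N C) :
    braidValue hF c (1 : BraidGroup N) = 1 := by
  rw [braidValue, map_one]
  rfl

theorem braidValue_mul (hF : IsWordCocycle w0 F) (c : Coloring N C) (β γ : BraidGroup N) :
    braidValue hF c (β * γ) = braidValue hF c β * braidValue hF ((perm N β)⁻¹ • c) γ := by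
  rw [braidValue, map_mul, SemidirectProduct.mul_left, Pi.mul_apply]
  congr 1
  change (cocycleHom hF N γ).left ((cocycleHom hF N β).right⁻¹ • c) = _
  rw [cocycleHom_right]
  rfl

theorem braidValue_σ (hF : IsWordCocycle w0 F) {c : Coloring N C} {i : Fin (N - 1)} {p : List C}
    {a b : C} {q : List C} (h : c.word = p ++ a :: b :: q) (hi : p.length = i)
    (hw : (p ++ a :: b :: q).Perm w0) : braidValue hF c (σ i) = F p a b q := by
  rw [braidValue, cocycleHom, lift_σ]
  exact letterValue_eq h hi hw

end Cocycle

/-- A property of braids that holds for the generators and is stable under products and inverses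
holds for all braids. -/
theorem induction {N : ℕ} {P : BraidGroup N → Prop} (one : P 1) (gen : ∀ i, P (σ i))
    (mul : ∀ β γ, P β → P γ → P (β * γ)) (inv : ∀ β, P β → P β⁻¹) (β : BraidGroup N) : P β := by
  have h : β ∈ Subgroup.closure (Set.range (σ : Fin (N - 1) → BraidGroup N)) := by
    have : Subgroup.closure (Set.range (σ : Fin (N - 1) → BraidGroup N)) = ⊤ :=
      PresentedGroup.closure_range_of _
    rw [this]
    exact Subgroup.mem_top β
  induction h using Subgroup.closure_induction with
  | mem x hx =>
    obtain ⟨i, rfl⟩ := hx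
    exact gen i
  | one => exact one
  | mul x y _ _ hx hy => exact mul x y hx hy
  | inv x _ hx => exact inv x hx

/-! ### Sorting braids -/

/-- The generator `σ_i`, trivial if `i` is out of range. -/
def letter (N i : ℕ) : BraidGroup N := if h : i < N - 1 then σ ⟨i, h⟩ else 1

theorem letter_comm (N : ℕ) {i j : ℕ} (h : i + 1 < j) :
    letter N i * letter N j = letter N j * letter N i := by
  unfold letter
  split_ifs
  · exact σ_comm _ _ h
  all_goals simp

theorem letter_braid {N i : ℕ} (h : i + 1 < N - 1) :
    letter N i * letter N (i + 1) * letter N i =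
      letter N (i + 1) * letter N i * letter N (i + 1) := by
  rw [letter, letter, dif_pos h, dif_pos (by omega)]
  exact σ_braid _ _ rfl

/-- The braid `σ_(o + k - 1) ⋯ σ_o`, which moves a strand from the position `o + k` to `o`. -/
def slide (N o : ℕ) : ℕ → BraidGroup N
  | 0 => 1
  | k + 1 => letter N (o + k) * slide N o k

theorem slide_succ_right (N o k : ℕ) :
    slide N o (k + 1) = slide N (o + 1) k * letter N o := by
  induction k with
  | zero => simp [slide]
  | succ k ih =>
    rw [slide, ih, slide, ← mul_assoc]
    congr 3
    omega

theorem letter_slide_of_lt (N : ℕ) {o k j : ℕ} (h : o + k < j) :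
    letter N j * slide N o k = slide N o k * letter N j := by
  induction k with
  | zero => simp [slide]
  | succ k ih =>
    rw [slide, ← mul_assoc, ← letter_comm N (by omega), mul_assoc, ih (by omega), mul_assoc]

theorem letter_slide_of_gt (N : ℕ) {o k j : ℕ} (h : j + 1 < o) :
    letter N j * slide N o k = slide N o k * letter N j := by
  induction k with
  | zero => simp [slide]
  | succ k ih =>
    rw [slide, ← mul_assoc, letter_comm N (by omega), mul_assoc, ih, mul_assoc]

theorem letter_slide {N o k i : ℕ} (hi : o ≤ i) (hik : i < o + k) (hN : o + k < N - 1) :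
    letter N i * slide N o (k + 1) = slide N o (k + 1) * letter N (i + 1) := by
  induction k with
  | zero => omega
  | succ k ih =>
    rcases Nat.lt_or_ge i (o + k) with h | h
    · rw [slide, ← mul_assoc, letter_comm N (by omega), mul_assoc, ih h (by omega), mul_assoc]
    · obtain rfl : i = o + k := by omega
      rw [slide, slide, ← mul_assoc, ← mul_assoc, ← add_assoc, letter_braid (by omega), mul_assoc,
        letter_slide_of_lt N (by omega)]
      simp only [mul_assoc]

theorem slide_slide {N o k m : ℕ} (hm : m ≤ k) (hN : o + k < N - 1) :
    slide N o m * slide N o (k + 1) = slide N o (k + 1) * slide N (o + 1) m := by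
  induction m with
  | zero => simp [slide]
  | succ m ih =>
    rw [slide, mul_assoc, ih (by omega), ← mul_assoc, letter_slide (by omega) (by omega) hN,
      slide, mul_assoc]
    congr 3
    omega

/-- The positive braid with fewest crossings that leads from the sorted word to the word `w`, on the
strands from position `o` on: it moves the first strand to its place and goes on with the rest. -/
def sortBraid {C : Type*} [LinearOrder C] (N : ℕ) : ℕ → List C → BraidGroup N
  | _, [] => 1
  | o, a :: w => slide N o (w.countP (· < a)) * sortBraid N (o + 1) w

section Sorting

variable {C : Type*} [LinearOrder C]

theorem letter_sortBraid (N : ℕ) {o j : ℕ} (w : List C) (h : j + 1 < o) :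
    letter N j * sortBraid N o w = sortBraid N o w * letter N j := by
  induction w generalizing o with
  | nil => simp [sortBraid]
  | cons a w ih =>
    rw [sortBraid, ← mul_assoc, letter_slide_of_gt N h, mul_assoc, ih (by omega), mul_assoc]

/-- Putting two adjacent letters out of order multiplies the sorting braid by one generator. -/
theorem sortBraid_swap {N o : ℕ} {p : List C} {a b : C} {q : List C} (hab : a < b)
    (hN : o + (p ++ b :: a :: q).length ≤ N) :
    sortBraid N o (p ++ b :: a :: q) =
      sortBraid N o (p ++ a :: b :: q) * letter N (o + p.length) := by
  induction p generalizing o with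
  | nil =>
    simp only [List.nil_append, sortBraid, List.length_nil, add_zero]
    have h1 : (a :: q).countP (· < b) = q.countP (· < b) + 1 :=
      List.countP_cons_of_pos (by simpa using hab)
    have h2 : (b :: q).countP (· < a) = q.countP (· < a) :=
      List.countP_cons_of_neg (by simpa using hab.le)
    have hle : q.countP (· < a) ≤ q.countP (· < b) :=
      List.countP_mono_left fun x _ hx => by
        simp only [decide_eq_true_eq] at hx ⊢
        exact hx.trans hab
    have hlen : q.countP (· < b) ≤ q.length := List.countP_le_length
    simp only [List.nil_append, List.length_cons] at hN
    rw [h1, h2, mul_assoc, mul_assoc, ← letter_sortBraid N q (by omega), ← mul_assoc,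
      ← slide_slide hle (by omega), slide_succ_right N o]
    simp only [mul_assoc]
  | cons x p ih =>
    simp only [List.cons_append, sortBraid, List.length_cons] at hN ⊢
    have hN' : o + 1 + (p ++ b :: a :: q).length ≤ N := by omega
    have hc : (p ++ b :: a :: q).countP (· < x) = (p ++ a :: b :: q).countP (· < x) :=
      ((List.Perm.swap a b q).append_left p).countP_eq _
    rw [ih hN', hc, mul_assoc, show o + 1 + p.length = o + (p.length + 1) by omega]

end Sorting

/-! ### Generators of the stabilizer of a colouring -/

theorem perm_σ {N : ℕ} (i : Fin (N - 1)) : perm N (σ i) = adjSwap i := lift_σ _ _ _ _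

section Loops

variable {N : ℕ} {C : Type*}

theorem length_lt_of_perm {c0 : Coloring N C} {p : List C} {a b : C} {q : List C}
    (hw : (p ++ a :: b :: q).Perm c0.word) : p.length < N - 1 := by
  have hl := hw.length_eq
  rw [length_word] at hl
  simp only [List.length_append, List.length_cons] at hl
  omega

theorem perm_swap_append {w0 : List C} {p : List C} {a b : C} {q : List C}
    (hw : (p ++ a :: b :: q).Perm w0) : (p ++ b :: a :: q).Perm w0 :=
  ((List.Perm.swap a b q).append_left p).trans hw

theorem word_perm_letter_smul {c c0 : Coloring N C} {p : List C} {a b : C} {q : List C}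
    (hc : c.word = p ++ a :: b :: q) (hw : (p ++ a :: b :: q).Perm c0.word) :
    (perm N (letter N p.length) • c).word = p ++ b :: a :: q := by
  rw [letter, dif_pos (length_lt_of_perm hw), perm_σ]
  exact word_adjSwap_smul hc rfl

variable [LinearOrder C]

/-- A braid that leads from the colouring `c0` to its rearrangement `w`, by way of the sorted
word. -/
def sortTo (c0 : Coloring N C) (w : List C) : BraidGroup N :=
  (sortBraid N 0 c0.word)⁻¹ * sortBraid N 0 w

theorem sortTo_word (c0 : Coloring N C) : sortTo c0 c0.word = 1 := inv_mul_cancel _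

theorem sortTo_swap {c0 : Coloring N C} {p : List C} {a b : C} {q : List C} (hab : a < b)
    (hw : (p ++ a :: b :: q).Perm c0.word) :
    sortTo c0 (p ++ b :: a :: q) = sortTo c0 (p ++ a :: b :: q) * letter N p.length := by
  have hl := hw.length_eq
  rw [length_word] at hl
  rw [sortTo, sortTo, mul_assoc, sortBraid_swap hab, zero_add]
  simp only [List.length_append, List.length_cons] at hl ⊢
  omega

theorem perm_letter_inv (N i : ℕ) : (perm N (letter N i))⁻¹ = perm N (letter N i) := by
  unfold letter
  split_ifs
  · rw [perm_σ, adjSwap_inv]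
  · simp

theorem word_inv_perm_sortTo_smul (c0 : Coloring N C) {w : List C} (hw : w.Perm c0.word) :
    ((perm N (sortTo c0 w))⁻¹ • c0).word = w := by
  suffices w.Perm c0.word ∧ ((perm N (sortTo c0 w))⁻¹ • c0).word = w from this.2
  refine List.Perm.adjacent_induction
    (P := fun w => w.Perm c0.word ∧ ((perm N (sortTo c0 w))⁻¹ • c0).word = w) ?_ hw.symm
    ⟨List.Perm.refl _, by rw [sortTo_word, map_one, inv_one, one_smul]⟩
  rintro p a b q ⟨hw, h⟩
  have hw' := perm_swap_append hw
  refine ⟨hw', ?_⟩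
  rcases lt_trichotomy a b with hab | rfl | hab
  · rw [sortTo_swap hab hw, map_mul, mul_inv_rev, mul_smul, perm_letter_inv]
    exact word_perm_letter_smul h hw
  · exact h
  · rw [sortTo_swap hab hw', map_mul, mul_inv_rev, mul_smul, perm_letter_inv] at h
    have := word_perm_letter_smul h hw
    rwa [← mul_smul, mul_eq_one_iff_inv_eq.mpr (perm_letter_inv N p.length), one_smul] at this

theorem inv_perm_sortTo_smul {c0 c : Coloring N C} (hc : c.word.Perm c0.word) :
    (perm N (sortTo c0 c.word))⁻¹ • c0 = c :=
  word_injective (word_inv_perm_sortTo_smul c0 hc)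

theorem sortTo_mul_mem {c0 : Coloring N C} {H : Subgroup (BraidGroup N)}
    (hH : ∀ β, β ∈ H ↔ perm N β • c0 = c0) {c c' : Coloring N C} (hc : c.word.Perm c0.word)
    (hc' : c'.word.Perm c0.word) {β : BraidGroup N} (h : perm N β • c' = c) :
    sortTo c0 c.word * β * (sortTo c0 c'.word)⁻¹ ∈ H := by
  rw [hH, map_mul, map_mul, map_inv, mul_smul, mul_smul, inv_perm_sortTo_smul hc', h,
    ← eq_inv_smul_iff, inv_perm_sortTo_smul hc]

theorem loop_mem {c0 : Coloring N C} {H : Subgroup (BraidGroup N)}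
    (hH : ∀ β, β ∈ H ↔ perm N β • c0 = c0) {p : List C} {a b : C} {q : List C}
    (hw : (p ++ a :: b :: q).Perm c0.word) :
    sortTo c0 (p ++ a :: b :: q) * letter N p.length * (sortTo c0 (p ++ b :: a :: q))⁻¹ ∈ H := by
  have h := word_inv_perm_sortTo_smul c0 hw
  have h' := word_inv_perm_sortTo_smul c0 (perm_swap_append hw)
  have := sortTo_mul_mem hH (c := (perm N (sortTo c0 (p ++ a :: b :: q)))⁻¹ • c0)
    (c' := (perm N (sortTo c0 (p ++ b :: a :: q)))⁻¹ • c0) (β := letter N p.length)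
    (by rwa [h]) (by rw [h']; exact perm_swap_append hw) (by
      apply word_injective
      rw [h]
      exact word_perm_letter_smul h' (perm_swap_append hw))
  rwa [h, h'] at this

/-- The element of the stabilizer of `c0` that leads to the word `p ++ a :: b :: q`, exchanges the
letters `a` and `b` and leads back. -/
def loop {c0 : Coloring N C} {H : Subgroup (BraidGroup N)}
    (hH : ∀ β, β ∈ H ↔ perm N β • c0 = c0) {p : List C} {a b : C} {q : List C}
    (hw : (p ++ a :: b :: q).Perm c0.word) : H :=
  ⟨sortTo c0 (p ++ a :: b :: q) * letter N p.length * (sortTo c0 (p ++ b :: a :: q))⁻¹,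
    loop_mem hH hw⟩

theorem eq_top_of_loop_mem {c0 : Coloring N C} {H : Subgroup (BraidGroup N)}
    (hH : ∀ β, β ∈ H ↔ perm N β • c0 = c0) (R : Subgroup H)
    (hR : ∀ p a b q, ∀ hw : (p ++ a :: b :: q).Perm c0.word, loop hH hw ∈ R) : R = ⊤ := by
  have key : ∀ β : BraidGroup N, ∀ c : Coloring N C, c.word.Perm c0.word →
      sortTo c0 c.word * β * (sortTo c0 ((perm N β)⁻¹ • c).word)⁻¹ ∈ R.map H.subtype := by
    intro β
    induction β using BraidGroup.induction with
    | one =>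
      intro c _
      rw [map_one, inv_one, one_smul, mul_one, mul_inv_cancel]
      exact one_mem _
    | gen i =>
      intro c hc
      obtain ⟨p, a, b, q, hx, hp⟩ := exists_eq_append_cons_cons (w := c.word) (i := i)
        (by rw [length_word]; omega)
      have h2 : ((perm N (σ i))⁻¹ • c).word = p ++ b :: a :: q := by
        rw [perm_σ, adjSwap_inv]
        exact word_adjSwap_smul hx hp
      rw [h2, hx]
      have hl : letter N p.length = σ i := by
        rw [letter, dif_pos (by omega)]
        congr
      rw [← hl]
      exact ⟨_, hR p a b q (hx ▸ hc), rfl⟩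
    | mul β γ hβ hγ =>
      intro c hc
      have h2 := mul_mem (hβ c hc) (hγ ((perm N β)⁻¹ • c) ((perm_word_smul_iff _ _).mpr hc))
      rw [← mul_smul, ← mul_inv_rev, ← map_mul] at h2
      convert h2 using 1
      group
    | inv β hβ =>
      intro c hc
      have h2 := inv_mem (hβ (perm N β • c) ((perm_word_smul_iff _ _).mpr hc))
      rw [inv_smul_smul] at h2
      rw [map_inv, inv_inv]
      convert h2 using 1
      group
  rw [eq_top_iff]
  rintro ⟨β, hβ⟩ -
  have h := key β c0 (List.Perm.refl _)
  have e : (perm N β)⁻¹ • c0 = c0 := by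
    rw [inv_smul_eq_iff, (hH β).mp hβ]
  rw [e, sortTo_word, one_mul, inv_one, mul_one] at h
  obtain ⟨x, hx, hxe⟩ := h
  have : x = ⟨β, hβ⟩ := Subtype.ext hxe
  rwa [this] at hx

/-! ### The tautological cocycle -/

/-- The cocycle whose values are the images of the loops under a homomorphism. -/
def loopValue {c0 : Coloring N C} {H : Subgroup (BraidGroup N)}
    (hH : ∀ β, β ∈ H ↔ perm N β • c0 = c0) {Γ : Type*} [Group Γ] (π : H →* Γ)
    (p : List C) (a b : C) (q : List C) : Γ :=
  if hw : (p ++ a :: b :: q).Perm c0.word then π (loop hH hw) else 1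

theorem loopValue_eq {c0 : Coloring N C} {H : Subgroup (BraidGroup N)}
    (hH : ∀ β, β ∈ H ↔ perm N β • c0 = c0) {Γ : Type*} [Group Γ] (π : H →* Γ)
    {p : List C} {a b : C} {q : List C} (hw : (p ++ a :: b :: q).Perm c0.word) :
    loopValue hH π p a b q = π (loop hH hw) := dif_pos hw

theorem loopValue_asc {c0 : Coloring N C} {H : Subgroup (BraidGroup N)}
    (hH : ∀ β, β ∈ H ↔ perm N β • c0 = c0) {Γ : Type*} [Group Γ] (π : H →* Γ)
    {p : List C} {a b : C} {q : List C} (hw : (p ++ a :: b :: q).Perm c0.word) (hab : a < b) :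
    loopValue hH π p a b q = 1 := by
  have : loop hH hw = 1 := by
    apply Subtype.ext
    change sortTo c0 (p ++ a :: b :: q) * letter N p.length *
      (sortTo c0 (p ++ b :: a :: q))⁻¹ = 1
    rw [sortTo_swap hab hw, mul_inv_cancel]
  rw [loopValue_eq hH π hw, this, map_one]

theorem isWordCocycle_loopValue {c0 : Coloring N C} {H : Subgroup (BraidGroup N)}
    (hH : ∀ β, β ∈ H ↔ perm N β • c0 = c0) {Γ : Type*} [Group Γ] (π : H →* Γ) :
    IsWordCocycle c0.word (loopValue hH π) where
  far p a b q c d r hw := by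
    have h2 : (p ++ b :: a :: q ++ c :: d :: r).Perm c0.word := by
      simpa using perm_swap_append hw
    have h3 : (p ++ a :: b :: q ++ c :: d :: r).Perm c0.word := by simpa using hw
    have h4 : (p ++ a :: b :: (q ++ d :: c :: r)).Perm c0.word := by
      simpa using perm_swap_append h3
    rw [loopValue_eq hH π hw, loopValue_eq hH π h2, loopValue_eq hH π h3, loopValue_eq hH π h4,
      ← map_mul, ← map_mul]
    congr 1
    apply Subtype.ext
    have hl := letter_comm N (i := p.length) (j := (p ++ a :: b :: q).length) (by simp)
    have e2 : (p ++ b :: a :: q).length = (p ++ a :: b :: q).length := by simp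
    simp only [loop, Subgroup.coe_mul, e2, List.append_assoc, List.cons_append, mul_assoc,
      inv_mul_cancel_left] at hl ⊢
    rw [← mul_assoc (letter N p.length), hl, mul_assoc]
  braid p a b c q hw := by
    have assoc : ∀ (u : C) v, p ++ [u] ++ v = p ++ u :: v := by simp
    have h2 : (p ++ [b] ++ a :: c :: q).Perm c0.word := by
      simpa using perm_swap_append hw
    have h3 : (p ++ b :: c :: a :: q).Perm c0.word := by simpa using perm_swap_append h2
    have h4 : (p ++ [a] ++ b :: c :: q).Perm c0.word := by simpa using hw
    have h5 : (p ++ a :: c :: b :: q).Perm c0.word := by simpa using perm_swap_append h4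
    have h6 : (p ++ [c] ++ a :: b :: q).Perm c0.word := by simpa using perm_swap_append h5
    rw [loopValue_eq hH π hw, loopValue_eq hH π h2, loopValue_eq hH π h3, loopValue_eq hH π h4,
      loopValue_eq hH π h5, loopValue_eq hH π h6, ← map_mul, ← map_mul, ← map_mul, ← map_mul]
    congr 1
    apply Subtype.ext
    have hl := letter_braid (N := N) (i := p.length)
      (by have := length_lt_of_perm h2; simpa using this)
    have hl' : ∀ t, letter N p.length * (letter N (p.length + 1) * (letter N p.length * t)) =
        letter N (p.length + 1) * (letter N p.length * (letter N (p.length + 1) * t)) := by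
      intro t
      simp only [← mul_assoc, hl]
    have e2 : ∀ u : C, (p ++ [u]).length = p.length + 1 := by simp
    simp only [loop, Subgroup.coe_mul, e2, assoc, mul_assoc, inv_mul_cancel_left, hl']

end Loops

/-! ### The homomorphism defined by a cocycle -/

section Hom

variable {N : ℕ} {C Γ : Type*} [Group Γ] {F : List C → C → C → List C → Γ}

theorem braidValue_letter {c0 : Coloring N C} (hF : IsWordCocycle c0.word F) {c : Coloring N C}
    {p : List C} {a b : C} {q : List C} (hc : c.word = p ++ a :: b :: q)
    (hw : (p ++ a :: b :: q).Perm c0.word) :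
    braidValue hF c (letter N p.length) = F p a b q := by
  rw [letter, dif_pos (length_lt_of_perm hw)]
  exact braidValue_σ hF hc rfl hw

variable [LinearOrder C]

/-- The restriction of a cocycle to the stabilizer of a colouring is a homomorphism. -/
noncomputable def stabilizerHom {c0 : Coloring N C} {H : Subgroup (BraidGroup N)}
    (hH : ∀ β, β ∈ H ↔ perm N β • c0 = c0) (hF : IsWordCocycle c0.word F) : H →* Γ where
  toFun β := braidValue hF c0 β
  map_one' := braidValue_one hF c0
  map_mul' β γ := by
    have e : (perm N β)⁻¹ • c0 = c0 := by
      rw [inv_smul_eq_iff, (hH β).mp β.2]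
    rw [Subgroup.coe_mul, braidValue_mul, e]

theorem braidValue_sortTo {c0 : Coloring N C} (hF : IsWordCocycle c0.word F)
    (hasc : ∀ p a b q, (p ++ a :: b :: q).Perm c0.word → a < b → F p a b q = 1)
    {w : List C} (hw : w.Perm c0.word) : braidValue hF c0 (sortTo c0 w) = 1 := by
  suffices w.Perm c0.word ∧ braidValue hF c0 (sortTo c0 w) = 1 from this.2
  refine List.Perm.adjacent_induction
    (P := fun w => w.Perm c0.word ∧ braidValue hF c0 (sortTo c0 w) = 1) ?_ hw.symm
    ⟨List.Perm.refl _, by rw [sortTo_word, braidValue_one]⟩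
  rintro p a b q ⟨hw, h⟩
  have hw' := perm_swap_append hw
  refine ⟨hw', ?_⟩
  rcases lt_trichotomy a b with hab | rfl | hab
  · rw [sortTo_swap hab hw, braidValue_mul, h, one_mul,
      braidValue_letter hF (word_inv_perm_sortTo_smul c0 hw) hw, hasc _ _ _ _ hw hab]
  · exact h
  · rwa [sortTo_swap hab hw', braidValue_mul,
      braidValue_letter hF (word_inv_perm_sortTo_smul c0 hw') hw', hasc _ _ _ _ hw' hab,
      mul_one] at h

/-- A cocycle that is trivial where strands are put out of order is trivial on the sorting braids,
so its value on a loop is its value on the crossing in the middle of the loop. -/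
theorem stabilizerHom_loop {c0 : Coloring N C} {H : Subgroup (BraidGroup N)}
    (hH : ∀ β, β ∈ H ↔ perm N β • c0 = c0) (hF : IsWordCocycle c0.word F)
    (hasc : ∀ p a b q, (p ++ a :: b :: q).Perm c0.word → a < b → F p a b q = 1)
    {p : List C} {a b : C} {q : List C} (hw : (p ++ a :: b :: q).Perm c0.word) :
    stabilizerHom hH hF (loop hH hw) = F p a b q := by
  have e : (perm N (loop hH hw : BraidGroup N))⁻¹ • c0 = c0 := by
    rw [inv_smul_eq_iff, (hH _).mp (loop hH hw).2]
  have h1 : braidValue hF c0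
      ((loop hH hw : BraidGroup N) * sortTo c0 (p ++ b :: a :: q)) = F p a b q := by
    rw [show (loop hH hw : BraidGroup N) * sortTo c0 (p ++ b :: a :: q) =
      sortTo c0 (p ++ a :: b :: q) * letter N p.length from inv_mul_cancel_right _ _,
      braidValue_mul, braidValue_sortTo hF hasc hw, one_mul,
      braidValue_letter hF (word_inv_perm_sortTo_smul c0 hw) hw]
  rwa [braidValue_mul, e, braidValue_sortTo hF hasc (perm_swap_append hw), mul_one] at h1

end Hom

/-! ### The quotients by the lower central series -/

/-- The linking cocycle induces an isomorphism from the quotient of the stabilizer of a colouring by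
a term of its lower central series, if the least colour occurs twice and every other colour at least
three times. -/
theorem exists_quotient_equiv_linkGroup {N l r : ℕ} (hr : 2 ≤ r) {c0 : Coloring N (Fin (l + 2))}
    {H : Subgroup (BraidGroup N)} (hH : ∀ β, β ∈ H ↔ perm N β • c0 = c0)
    (h0 : c0.word.count 0 = 2) (h3 : ∀ c, c ≠ 0 → 3 ≤ c0.word.count c) :
    ∃ e : H ⧸ Gam r H ≃* LinkGroup (2 ^ (r - 2)) l, ∀ β : H,
      e β = stabilizerHom hH (isWordCocycle_linkCocycle (2 ^ (r - 2)) h0) β := by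
  have hr' : r - 1 = r - 2 + 1 := by omega
  set φ := stabilizerHom hH (isWordCocycle_linkCocycle (2 ^ (r - 2)) h0) with hφ
  have hφl := fun p a b q hw => stabilizerHom_loop hH
    (isWordCocycle_linkCocycle (2 ^ (r - 2)) h0)
    (fun p a b q _ hab => linkCocycle_asc _ p hab q) (p := p) (a := a) (b := b) (q := q) hw
  have hsurj : Function.Surjective φ := by
    rw [← MonoidHom.range_eq_top]
    refine eq_top_of_linkCocycle_mem (w0 := c0.word) _ (fun c => ?_) _ fun p x y q hw =>
      ⟨loop hH hw, hφl p x y q hw⟩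
    rcases eq_or_ne c 0 with rfl | hc
    · exact h0.ge
    · have := h3 c hc
      omega
  have hΓ : (⊤ : Subgroup (H ⧸ Gam r H)).lowerCentralSeries (r - 2 + 1) = ⊥ := by
    rw [← hr', lowerCentralSeries_quotient_Gam]
  have hsorted : IsSortedCocycle 0 c0.word (loopValue hH (QuotientGroup.mk' (Gam r H))) :=
    { isWordCocycle_loopValue hH _ with
      asc := fun p a b q hw hab => loopValue_asc hH _ hw hab
      bot := Fin.zero_le
      count_bot := h0
      count_ne := h3
      eq_of_braid := fun x y h => eq_of_braid_of_lowerCentralSeries_eq_bot hΓ h }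
  obtain ⟨ψ, hψ⟩ := exists_hom_of_isSortedCocycle hsorted hΓ (by
    intro R hR
    have := eq_top_of_loop_mem hH (R.comap (QuotientGroup.mk' (Gam r H))) fun p a b q hw => by
      have h := hR p a b q hw
      rwa [loopValue_eq hH _ hw] at h
    rw [eq_top_iff]
    rintro x -
    obtain ⟨y, rfl⟩ := QuotientGroup.mk'_surjective _ x
    exact this.ge (Subgroup.mem_top y))
  have hψφ : ∀ β : H, ψ (φ β) = QuotientGroup.mk' (Gam r H) β := by
    have := eq_top_of_loop_mem hH ((ψ.comp φ).eqLocus (QuotientGroup.mk' (Gam r H)))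
      fun p a b q hw => by
        change ψ (φ _) = _
        rw [hφl p a b q hw, hψ p a b q hw, loopValue_eq hH _ hw]
    intro β
    exact this.ge (Subgroup.mem_top β)
  have hker : φ.ker = Gam r H := by
    apply le_antisymm
    · intro β hβ
      have := hψφ β
      rw [MonoidHom.mem_ker.mp hβ, map_one] at this
      exact (QuotientGroup.eq_one_iff β).mp this.symm
    · intro β hβ
      have := Gam_le_comap r φ hβ
      rw [Subgroup.mem_comap, Gam, hr', lowerCentralSeries_linkGroup_eq_bot] at this
      exact this
  exact ⟨(QuotientGroup.quotientMulEquivOfEq hker.symm).trans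
    (QuotientGroup.quotientKerEquivOfSurjective φ hsurj), fun _ => rfl⟩

/-! ### Forgetting all strands but those of the last block -/

/-- The exponent sum of a braid. -/
def exponent (n : ℕ) : BraidGroup n →* Multiplicative ℤ :=
  lift (fun _ => .ofAdd 1) (fun _ _ _ => rfl) (fun _ _ _ => rfl)

theorem exponent_σ {n : ℕ} (i : Fin (n - 1)) : exponent n (σ i) = .ofAdd 1 := lift_σ _ _ _ _

/-- In a nilpotent quotient of the braid group all generators coincide, hence the terms of the
lower central series from the second one on consist of the braids of exponent sum zero. -/
theorem mem_Gam_iff {n r : ℕ} (hr : 2 ≤ r) (β : BraidGroup n) :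
    β ∈ Gam r (BraidGroup n) ↔ exponent n β = 1 := by
  constructor
  · intro h
    have := Gam_le_comap r (exponent n) h
    rwa [Subgroup.mem_comap, Gam_eq_bot_of_comm hr, Subgroup.mem_bot] at this
  · intro h
    set π := QuotientGroup.mk' (Gam r (BraidGroup n))
    have hΓ := lowerCentralSeries_quotient_Gam r (BraidGroup n)
    have hσ : ∀ i j : Fin (n - 1), π (σ i) = π (σ j) := by
      have h1 : ∀ (k : ℕ) (hk : k < n - 1), π (σ ⟨k, hk⟩) = π (σ ⟨0, by omega⟩) := by
        intro k
        induction k with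
        | zero => intro _; rfl
        | succ k ih =>
          intro hk
          rw [← ih (by omega)]
          refine (eq_of_braid_of_lowerCentralSeries_eq_bot hΓ ?_).symm
          rw [← map_mul, ← map_mul, ← map_mul, ← map_mul]
          exact congrArg π (σ_braid ⟨k, by omega⟩ ⟨k + 1, hk⟩ rfl)
      intro i j
      rw [h1 i i.2, h1 j j.2]
    rw [← QuotientGroup.eq_one_iff]
    change π β = 1
    rcases Nat.eq_zero_or_pos (n - 1) with h0 | h0
    · have : π = 1 := PresentedGroup.ext fun i => absurd i.2 (by omega)
      rw [this, MonoidHom.one_apply]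
    · have : π = (zpowersHom _ (π (σ ⟨0, h0⟩))).comp (exponent n) := by
        refine PresentedGroup.ext fun i => ?_
        change π (σ i) = zpowersHom _ _ (exponent n (σ i))
        rw [exponent_σ, zpowersHom_apply, toAdd_ofAdd, zpow_one, hσ]
      rw [this, MonoidHom.comp_apply, h, map_one]

theorem keepAll_mul_left {N n : ℕ} (β γ : BraidGroup N) (S : Set.powersetCard (Fin N) n) :
    (keepAll N n (β * γ)).left S =
      (keepAll N n β).left S * (keepAll N n γ).left ((perm N β)⁻¹ • S) := by
  rw [map_mul, SemidirectProduct.mul_left, Pi.mul_apply]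
  congr 1
  change (keepAll N n γ).left ((keepAll N n β).right⁻¹ • S) = _
  rw [keepAll_right]

theorem keepAll_σ_left {N n : ℕ} (i : Fin (N - 1)) (S : Set.powersetCard (Fin N) n) :
    (keepAll N n (σ i)).left S = keepLetter n i S := by
  rw [keepAll, lift_σ]

theorem exponent_keepLetter {N n : ℕ} (i : Fin (N - 1)) (S : Set.powersetCard (Fin N) n) :
    exponent n (keepLetter n i S) =
      if posL i ∈ (S : Finset (Fin N)) ∧ posR i ∈ (S : Finset (Fin N)) then .ofAdd 1 else 1 := by
  unfold keepLetter
  split_ifs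
  · exact exponent_σ _
  · exact map_one _

/-- The exponent sum of the crossings inside the last block. -/
def lastValue (a l : ℕ) : LinkGroup a l →* Multiplicative ℤ :=
  (AddMonoidHom.toMultiplicative
    (Pi.evalAddMonoidHom (fun _ => ℤ) s(Fin.last l, Fin.last l))).comp (MonoidHom.fst _ _)

theorem lastValue_linkCocycle (a : ℕ) {l : ℕ} (p : List (Fin (l + 2))) (x y : Fin (l + 2))
    (q : List (Fin (l + 2))) : lastValue a l (linkCocycle a p x y q) =
      if x = Fin.last (l + 1) ∧ y = Fin.last (l + 1) then .ofAdd 1 else 1 := by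
  have hz : (0 : Fin (l + 2)) ≠ Fin.last (l + 1) := (Fin.last_pos).ne
  change Multiplicative.ofAdd ((pairValue x y).toAdd s(Fin.last l, Fin.last l)) = _
  cases x using Fin.cases with
  | zero =>
    rw [if_neg fun h => hz h.1]
    rfl
  | succ i =>
    cases y using Fin.cases with
    | zero =>
      rw [if_neg fun h => hz h.2]
      rfl
    | succ j =>
      rw [pairValue_succ]
      simp only [← Fin.succ_last, Fin.succ_inj]
      by_cases h : i = Fin.last l ∧ j = Fin.last l
      · obtain ⟨rfl, rfl⟩ := h
        simp
      · rw [if_neg h]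
        split_ifs with hji
        · rw [toAdd_ofAdd, Pi.single_eq_of_ne, ofAdd_zero]
          simpa [eq_comm] using h
        · rfl

theorem braidValue_inv {N : ℕ} {C Γ : Type*} [Group Γ] {w0 : List C}
    {F : List C → C → C → List C → Γ} (hF : IsWordCocycle w0 F) (c : Coloring N C)
    (β : BraidGroup N) : braidValue hF c β⁻¹ = (braidValue hF (perm N β • c) β)⁻¹ := by
  have h := braidValue_mul hF (perm N β • c) β β⁻¹
  rw [mul_inv_cancel, braidValue_one, inv_smul_smul] at h
  exact (inv_eq_of_mul_eq_one_right h.symm).symm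

/-- The exponent sum of what remains of a braid when the strands of the last colour are kept is read
off from the linking cocycle. -/
theorem exponent_keepAll {N n l a : ℕ} {w0 : List (Fin (l + 2))} (hw0 : w0.count 0 = 2)
    (β : BraidGroup N) (c : Coloring N (Fin (l + 2))) (hc : c.word.Perm w0)
    (S : Set.powersetCard (Fin N) n)
    (hS : ∀ p, p ∈ (S : Finset (Fin N)) ↔ c p = Fin.last (l + 1)) :
    exponent n ((keepAll N n β).left S) =
      lastValue a l (braidValue (isWordCocycle_linkCocycle a hw0) c β) := by
  have hsmul : ∀ (π : Equiv.Perm (Fin N)) (c : Coloring N (Fin (l + 2)))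
      (S : Set.powersetCard (Fin N) n),
      (∀ p, p ∈ (S : Finset (Fin N)) ↔ c p = Fin.last (l + 1)) →
      ∀ p, p ∈ ((π • S : Set.powersetCard (Fin N) n) : Finset (Fin N)) ↔
        (π • c) p = Fin.last (l + 1) := by
    intro π c S hS p
    rw [Set.powersetCard.coe_smul, ← Finset.inv_smul_mem_iff, smul_apply]
    exact hS _
  induction β using BraidGroup.induction generalizing c S with
  | one =>
    rw [map_one, braidValue_one, map_one]
    exact map_one _
  | gen i =>
    rw [keepAll_σ_left, exponent_keepLetter, braidValue, cocycleHom, lift_σ]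
    change _ = lastValue a l (letterValue w0 (linkCocycle a) i c)
    rw [letterValue, if_pos hc, lastValue_linkCocycle]
    simp only [hS]
  | mul β γ hβ hγ =>
    rw [keepAll_mul_left, braidValue_mul, map_mul, map_mul, hβ c hc S hS,
      hγ _ ((perm_word_smul_iff _ _).mpr hc) _ (hsmul _ c S hS)]
  | inv β hβ =>
    have h1 := keepAll_mul_left β β⁻¹ (perm N β • S)
    rw [mul_inv_cancel, map_one, inv_smul_smul] at h1
    have h2 := (inv_eq_of_mul_eq_one_right h1.symm).symm
    rw [h2, braidValue_inv, map_inv, map_inv,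
      hβ _ ((perm_word_smul_iff _ _).mpr hc) _ (hsmul _ c S hS)]

end BraidGroup

/-! ### The layer groups of partitioned braid groups -/

open BraidGroup

/-- The colouring of the positions by the blocks that contain them. -/
def blockColoring {m : ℕ} (lam : Fin m → ℕ) : Coloring (∑ i, lam i) (Fin m) := blockOf lam

theorem mem_partBraidGroup_iff {m : ℕ} (lam : Fin m → ℕ) (β : BraidGroup (∑ i, lam i)) :
    β ∈ partBraidGroup lam ↔ perm _ β • blockColoring lam = blockColoring lam := by
  rw [← eq_inv_smul_iff, eq_comm]
  have h : ∀ p, ((perm _ β)⁻¹ • blockColoring lam) p = blockOf lam (perm _ β p) := fun p => by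
    rw [Coloring.smul_apply, inv_inv]
    rfl
  exact ⟨fun hβ => funext fun p => (h p).trans (hβ p), fun hβ p => (h p).symm.trans (congrFun hβ p)⟩

theorem count_word_blockColoring {m : ℕ} (lam : Fin m → ℕ) (j : Fin m) :
    (blockColoring lam).word.count j = lam j := by
  have h : (blockSet lam j : Finset (Fin (∑ i, lam i))).card = lam j := (blockSet lam j).2
  rw [← h]
  change List.count j (List.ofFn (blockOf lam)) =
    (Finset.univ.filter fun p => blockOf lam p = j).card
  rw [List.ofFn_eq_map, List.count, List.countP_map, List.countP_eq_length_filter,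
    ← List.toFinset_card_of_nodup ((List.nodup_finRange _).filter _)]
  congr 1
  ext p
  simp

theorem blocks2kn_zero {l : ℕ} (k : Fin l → ℕ) (n : ℕ) : blocks2kn k n 0 = 2 := by
  have : (0 : Fin (l + 2)) = Fin.castSucc 0 := rfl
  rw [this, blocks2kn, Fin.snoc_castSucc, Fin.cons_zero]

theorem three_le_blocks2kn {l : ℕ} {k : Fin l → ℕ} {n : ℕ} (hk : ∀ i, 3 ≤ k i) (hn : 3 ≤ n)
    (c : Fin (l + 2)) (hc : c ≠ 0) : 3 ≤ blocks2kn k n c := by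
  induction c using Fin.lastCases with
  | last => rwa [blocks2kn_last]
  | cast c =>
    rw [blocks2kn, Fin.snoc_castSucc]
    cases c using Fin.cases with
    | zero => exact absurd rfl hc
    | succ i => exact hk i

/-- Removing the exponent sum of the last block from `LinkGroup a l`. -/
theorem nonempty_ker_lastValue_equiv (a l : ℕ) :
    Nonempty ((lastValue a l).ker ≃*
      Multiplicative (Fin ((l + 2).choose 2 - 1) → ℤ) × SwapGroup a (l + 1)) := by
  have hcard : Fintype.card {z : Sym2 (Fin (l + 1)) // z ≠ s(Fin.last l, Fin.last l)} =
      (l + 2).choose 2 - 1 := by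
    rw [Fintype.card_subtype_compl, Sym2.card, Fintype.card_fin, Fintype.card_subtype_eq]
  let ε := Fintype.equivFinOfCardEq hcard
  refine ⟨⟨⟨fun x => (.ofAdd fun i => x.1.1.toAdd (ε.symm i).1, x.1.2),
    fun x => ⟨(.ofAdd fun z => if h : z = s(Fin.last l, Fin.last l) then 0
      else x.1.toAdd (ε ⟨z, h⟩), x.2), ?_⟩, ?_, ?_⟩, fun _ _ => rfl⟩⟩
  · rw [MonoidHom.mem_ker]
    change Multiplicative.ofAdd (dite _ _ _) = 1
    rw [dif_pos rfl]
    rfl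
  · rintro ⟨⟨z, v⟩, hx⟩
    refine Subtype.ext (Prod.ext ?_ rfl)
    apply Multiplicative.toAdd.injective
    funext y
    change dite _ _ _ = z.toAdd y
    split_ifs with h
    · rw [h]
      exact (congrArg Multiplicative.toAdd (MonoidHom.mem_ker.mp hx)).symm
    · simp
  · rintro ⟨z, v⟩
    refine Prod.ext ?_ rfl
    apply Multiplicative.toAdd.injective
    funext i
    change dite _ _ _ = z.toAdd i
    rw [dif_neg (ε.symm i).2]
    simp

theorem mainTheorem7 (l : ℕ) (k : Fin l → ℕ) (n r : ℕ)
    (hk : ∀ i, 3 ≤ k i) (hn : 3 ≤ n) (hr : 2 ≤ r) :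
    Nonempty (LayerQ k n r ≃*
      Multiplicative (Fin ((l + 2).choose 2 - 1) → ℤ) ×
        (Multiplicative (Fin (l + 1) → SqMod (2 ^ (r - 2))) ⋊[swapAction (2 ^ (r - 2)) (l + 1)]
          Multiplicative ℤ)) := by
  set lam := blocks2kn k n
  have h0 : (blockColoring lam).word.count 0 = 2 :=
    (count_word_blockColoring lam 0).trans (blocks2kn_zero k n)
  have h3 : ∀ c, c ≠ 0 →
      3 ≤ (blockColoring lam).word.count c :=
    fun c hc => (three_le_blocks2kn hk hn c hc).trans_eq (count_word_blockColoring lam c).symm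
  obtain ⟨e, he⟩ := exists_quotient_equiv_linkGroup hr (mem_partBraidGroup_iff lam) h0 h3
  -- The layer group is the kernel of the exponent sum of the last block, because `Γ_r` of the braid
  -- group on that block consists of the braids of exponent sum zero.
  have hmap : (layerGroup r (keepBlock lam (Fin.last (l + 1)))).map e.toMonoidHom =
      (lastValue (2 ^ (r - 2)) l).ker := by
    ext x
    obtain ⟨y, rfl⟩ := e.surjective x
    obtain ⟨β, rfl⟩ := QuotientGroup.mk_surjective y
    have h1 : e (β : partBraidGroup lam ⧸ Gam r (partBraidGroup lam)) ∈
        (layerGroup r (keepBlock lam (Fin.last (l + 1)))).map e.toMonoidHom ↔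
        (β : partBraidGroup lam ⧸ Gam r (partBraidGroup lam)) ∈
          layerGroup r (keepBlock lam (Fin.last (l + 1))) :=
      Subgroup.mem_map_iff_mem e.injective
    rw [h1, MonoidHom.mem_ker, QuotientGroup.map_mk, QuotientGroup.eq_one_iff, mem_Gam_iff hr,
      MonoidHom.mem_ker, he, stabilizerHom]
    have h2 := exponent_keepAll (a := 2 ^ (r - 2)) h0 (β : BraidGroup (∑ i, lam i))
      (blockColoring lam) (List.Perm.refl _) (blockSet lam (Fin.last (l + 1))) (fun p => by
        change p ∈ Finset.univ.filter (fun p => blockOf lam p = Fin.last (l + 1)) ↔ _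
        rw [Finset.mem_filter_univ]
        rfl)
    exact Eq.congr_left h2
  obtain ⟨f⟩ := nonempty_ker_lastValue_equiv (2 ^ (r - 2)) l
  exact ⟨(e.subgroupMap _).trans ((MulEquiv.subgroupCongr hmap).trans f)⟩
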